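/- Let $n,m_1,m_2$ be non-negative integers, $m=m_1+m_2$, $j=\mathrm{diag}(I_{m_1},-I_{m_2})$, $P_1=(I_m+j)/2$, $P_2=(I_m-j)/2$. Let $\alpha,S_0\in\mathbb C^{n\times n}$, $\vartheta_1\in\mathbb C^{n\times m_1}$, $\vartheta_2\in\mathbb C^{n\times m_2}$ form a strongly admissible quadruple, that is, $S_0>0$, $\alpha S_0-S_0\alpha^*=i(\vartheta_1\vartheta_1^*+\vartheta_2\vartheta_2^*)$, and the pair $\{\alpha,\vartheta_1\}$ is controllable: the images of $\alpha^\nu\vartheta_1$ $(0\le\nu\le n-1)$ span $\mathbb C^n$. Assume $i\notin\sigma(\alpha)$. Then there is a unique pair of matrix functions $\Lambda_0(t)$ $(n\times m)$ and $S_0(t)$ $(n\times n)$ on $\mathbb R$ with $\Lambda_0(0)=[\vartheta_1\ \vartheta_2]$, $S_0(0)=S_0$ and $$\Lambda_0'(t)=-2\big((\alpha-iI_n)^{-1}\Lambda_0(t)P_1+(\alpha+iI_n)^{-1}\Lambda_0(t)P_2\big),$$ $$\begin{aligned}S_0'(t)=-\Big(&(\alpha-iI_n)^{-1}S_0(t)+(\alpha+iI_n)^{-1}S_0(t)+S_0(t)(\alpha^*+iI_n)^{-1}+S_0(t)(\alpha^*-iI_n)^{-1}\\&+2(\alpha^2+I_n)^{-1}\big(\alpha\Lambda_0(t)j\Lambda_0(t)^*+\Lambda_0(t)j\Lambda_0(t)^*\alpha^*\big)((\alpha^*)^2+I_n)^{-1}\Big).\end{aligned}$$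 For each $t\in\mathbb R$ define, starting from $\Lambda_0(t),S_0(t)$, $$\Lambda_{k+1}=\Lambda_k+i\alpha^{-1}\Lambda_kj,\qquad S_{k+1}=S_k+\alpha^{-1}S_k(\alpha^{-1})^*+\alpha^{-1}\Lambda_kj\Lambda_k^*(\alpha^{-1})^*,$$ $$C_k(t)=j+\Lambda_k^*S_k^{-1}\Lambda_k-\Lambda_{k+1}^*S_{k+1}^{-1}\Lambda_{k+1}\qquad(k=0,1,2,\dots).$$ For each $t\in\mathbb R$ and $k$, the quadruple formed by $\alpha$, $S_k$ and the two column blocks of $\Lambda_k$ (of $m_1$ and $m_2$ columns) is strongly admissible, and $C_k(t)=U_k^*jU_k$ for some unitary $U_k$, so that $$y_{k+1}=\Big(I_m+\frac iz C_k(t)\Big)y_k\qquad(k=0,1,2,\dots)$$ is a discrete skew-selfadjoint Dirac system. Let $w_k(t,z)$ be its fundamental solution with $w_0=I_m$. A Weyl function of this system is an $m_1\times m_2$ matrix function $\varphi$, meromorphic on a half-plane $\mathbb C_M=\{z:\Im z>M\}$ for some $M>0$, such that $$\sum_{k=0}^\infty\begin{bmatrix}\varphi(z)^*&I_{m_2}\end{bmatrix}w_k(t,z)^*w_k(t,z)\begin{bmatrix}\varphi(z)\\I_{m_2}\end{bmatrix}<\infty$$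 for $z\in\mathbb C_M$ off a subset without accumulation points in $\mathbb C_M$. For every $t\in\mathbb R$ the Weyl function of this system exists, is unique (as a meromorphic function), and is given by $$\varphi(t,z)=-i\,\vartheta_1^*e^{-2t(\alpha^*+iI_n)^{-1}}S_0(t)^{-1}(zI_n+\beta(t))^{-1}e^{-2t(\alpha+iI_n)^{-1}}\vartheta_2,$$ $$\beta(t)=\alpha-i\,e^{-2t(\alpha+iI_n)^{-1}}\vartheta_2\vartheta_2^*e^{-2t(\alpha^*-iI_n)^{-1}}S_0(t)^{-1}.$$ That is, this function is a Weyl function on $\mathbb C_{1/2}$, with the above series convergent at every $z$ with $\Im z>\frac12$ and $\det(zI_n+\beta(t))\neq0$; and every Weyl function of the system, on any $\mathbb C_M$ with $M>0$, coincides with it on $\mathbb C_M$ as a meromorphic function. -/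

import Mathlib

open scoped Matrix ComplexOrder

noncomputable section

namespace DGHM

/-- The pair `{α, θ}` is controllable: the images of `α ^ ν * θ`, `0 ≤ ν ≤ n - 1`, span `ℂⁿ`. -/
def IsControllable {n m : ℕ} (α : Matrix (Fin n) (Fin n) ℂ) (θ : Matrix (Fin n) (Fin m) ℂ) :
    Prop :=
  (⨆ ν : Fin n, LinearMap.range (Matrix.mulVecLin (α ^ (ν : ℕ) * θ))) = ⊤

/-- The quadruple `{α, S, θ₁, θ₂}` is admissible. -/
def IsAdmissible {n m₁ m₂ : ℕ} (α S : Matrix (Fin n) (Fin n) ℂ)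
    (θ₁ : Matrix (Fin n) (Fin m₁) ℂ) (θ₂ : Matrix (Fin n) (Fin m₂) ℂ) : Prop :=
  S.PosDef ∧ α * S - S * αᴴ = Complex.I • (θ₁ * θ₁ᴴ + θ₂ * θ₂ᴴ)

/-- The quadruple `{α, S, θ₁, θ₂}` is strongly admissible. -/
def IsStronglyAdmissible {n m₁ m₂ : ℕ} (α S : Matrix (Fin n) (Fin n) ℂ)
    (θ₁ : Matrix (Fin n) (Fin m₁) ℂ) (θ₂ : Matrix (Fin n) (Fin m₂) ℂ) : Prop :=
  IsAdmissible α S θ₁ θ₂ ∧ IsControllable α θ₁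

/-- The signature matrix `j = diag(I_{m₁}, -I_{m₂})`. -/
def sig (m₁ m₂ : ℕ) : Matrix (Fin m₁ ⊕ Fin m₂) (Fin m₁ ⊕ Fin m₂) ℂ :=
  Matrix.fromBlocks 1 0 0 (-1)

/-- The projection `P₁ = (I + j) / 2`. -/
def proj₁ (m₁ m₂ : ℕ) : Matrix (Fin m₁ ⊕ Fin m₂) (Fin m₁ ⊕ Fin m₂) ℂ :=
  (1 / 2 : ℂ) • (1 + sig m₁ m₂)

/-- The projection `P₂ = (I - j) / 2`. -/
def proj₂ (m₁ m₂ : ℕ) : Matrix (Fin m₁ ⊕ Fin m₂) (Fin m₁ ⊕ Fin m₂) ℂ :=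
  (1 / 2 : ℂ) • (1 - sig m₁ m₂)

/-- The sequence `Λ_{k+1} = Λ_k + i α⁻¹ Λ_k j` with initial value `Λ`. -/
def lamSeq {n m₁ m₂ : ℕ} (α : Matrix (Fin n) (Fin n) ℂ)
    (Λ : Matrix (Fin n) (Fin m₁ ⊕ Fin m₂) ℂ) : ℕ → Matrix (Fin n) (Fin m₁ ⊕ Fin m₂) ℂ
  | 0 => Λ
  | k + 1 => lamSeq α Λ k + Complex.I • (α⁻¹ * lamSeq α Λ k * sig m₁ m₂)

/-- The sequence `S_{k+1} = S_k + α⁻¹ S_k α⁻* + α⁻¹ Λ_k j Λ_k* α⁻*` with initial value `S`. -/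
def SSeq {n m₁ m₂ : ℕ} (α : Matrix (Fin n) (Fin n) ℂ)
    (Λ : Matrix (Fin n) (Fin m₁ ⊕ Fin m₂) ℂ) (S : Matrix (Fin n) (Fin n) ℂ) :
    ℕ → Matrix (Fin n) (Fin n) ℂ
  | 0 => S
  | k + 1 => SSeq α Λ S k + α⁻¹ * SSeq α Λ S k * (α⁻¹)ᴴ
      + α⁻¹ * lamSeq α Λ k * sig m₁ m₂ * (lamSeq α Λ k)ᴴ * (α⁻¹)ᴴ

/-- The potential
`C_k = j + Λ_k* S_k⁻¹ Λ_k - Λ_{k+1}* S_{k+1}⁻¹ Λ_{k+1}` generated by `{α, S, Λ}`. -/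
def potential {n m₁ m₂ : ℕ} (α : Matrix (Fin n) (Fin n) ℂ)
    (Λ : Matrix (Fin n) (Fin m₁ ⊕ Fin m₂) ℂ) (S : Matrix (Fin n) (Fin n) ℂ) (k : ℕ) :
    Matrix (Fin m₁ ⊕ Fin m₂) (Fin m₁ ⊕ Fin m₂) ℂ :=
  sig m₁ m₂ + (lamSeq α Λ k)ᴴ * (SSeq α Λ S k)⁻¹ * lamSeq α Λ k
    - (lamSeq α Λ (k + 1))ᴴ * (SSeq α Λ S (k + 1))⁻¹ * lamSeq α Λ (k + 1)

/-- `C` is the potential of a discrete skew-selfadjoint Dirac system: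
`C_k = U_k* j U_k` with unitary `U_k`. -/
def IsDiracPotential {m₁ m₂ : ℕ}
    (C : ℕ → Matrix (Fin m₁ ⊕ Fin m₂) (Fin m₁ ⊕ Fin m₂) ℂ) : Prop :=
  ∀ k, ∃ U ∈ Matrix.unitaryGroup (Fin m₁ ⊕ Fin m₂) ℂ, C k = Uᴴ * sig m₁ m₂ * U

/-- The fundamental solution of `y_{k+1} = (I + (i/z) C_k) y_k` normalized at `k = 0` by `I`. -/
def fundSol {m₁ m₂ : ℕ} (C : ℕ → Matrix (Fin m₁ ⊕ Fin m₂) (Fin m₁ ⊕ Fin m₂) ℂ) (z : ℂ) :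
    ℕ → Matrix (Fin m₁ ⊕ Fin m₂) (Fin m₁ ⊕ Fin m₂) ℂ
  | 0 => 1
  | k + 1 => (1 + (Complex.I / z) • C k) * fundSol C z k

/-- Convergence of `∑ [X* I] w_k(z)* w_k(z) [X; I]`. -/
def WeylSummable {m₁ m₂ : ℕ} (C : ℕ → Matrix (Fin m₁ ⊕ Fin m₂) (Fin m₁ ⊕ Fin m₂) ℂ)
    (z : ℂ) (X : Matrix (Fin m₁) (Fin m₂) ℂ) : Prop :=
  Summable fun k : ℕ =>
    Matrix.fromCols Xᴴ (1 : Matrix (Fin m₂) (Fin m₂) ℂ) * (fundSol C z k)ᴴ * fundSol C z k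
      * Matrix.fromRows X (1 : Matrix (Fin m₂) (Fin m₂) ℂ)

/-- The half-plane `ℂ_M`. -/
def halfPlane (M : ℝ) : Set ℂ := {z | M < z.im}

/-- `φ` is a Weyl function, on `ℂ_M`, of the system with potential `C`: it is a meromorphic
matrix function on `ℂ_M` with `∑ [φ* I] w_k* w_k [φ; I] < ∞`. Values of a meromorphic
function matter only off a relatively discrete closed subset of `ℂ_M` (containing the poles). -/
structure IsWeylFunction {m₁ m₂ : ℕ} (M : ℝ)
    (C : ℕ → Matrix (Fin m₁ ⊕ Fin m₂) (Fin m₁ ⊕ Fin m₂) ℂ)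
    (φ : ℂ → Matrix (Fin m₁) (Fin m₂) ℂ) : Prop where
  pos : 0 < M
  meromorphic : ∀ a b, MeromorphicOn (fun z => φ z a b) (halfPlane M)
  summable : ∀ᶠ z in Filter.codiscreteWithin (halfPlane M), WeylSummable C z (φ z)

/-- `(Λ(t), S(t))`, `t ∈ ℝ`, is the time evolution of the quadruple `{α, S₀, θ₁, θ₂}`, that is,
the solution of the system of differential equations for `Λ₀(t) = [θ₁(t) θ₂(t)]` and `S₀(t)`. -/
structure IsTimeEvolution {n m₁ m₂ : ℕ} (α S₀ : Matrix (Fin n) (Fin n) ℂ)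
    (θ₁ : Matrix (Fin n) (Fin m₁) ℂ) (θ₂ : Matrix (Fin n) (Fin m₂) ℂ)
    (Λ : ℝ → Matrix (Fin n) (Fin m₁ ⊕ Fin m₂) ℂ) (S : ℝ → Matrix (Fin n) (Fin n) ℂ) :
    Prop where
  lam_zero : Λ 0 = Matrix.fromCols θ₁ θ₂
  S_zero : S 0 = S₀
  lam_deriv : ∀ t : ℝ, HasDerivAt Λ
    ((-2 : ℂ) • ((α - Complex.I • 1)⁻¹ * Λ t * proj₁ m₁ m₂
      + (α + Complex.I • 1)⁻¹ * Λ t * proj₂ m₁ m₂)) t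
  S_deriv : ∀ t : ℝ, HasDerivAt S
    (-((α - Complex.I • 1)⁻¹ * S t + (α + Complex.I • 1)⁻¹ * S t
      + S t * (αᴴ + Complex.I • 1)⁻¹ + S t * (αᴴ - Complex.I • 1)⁻¹
      + (2 : ℂ) • ((α ^ 2 + 1)⁻¹
        * (α * Λ t * sig m₁ m₂ * (Λ t)ᴴ + Λ t * sig m₁ m₂ * (Λ t)ᴴ * αᴴ)
        * (αᴴ ^ 2 + 1)⁻¹))) t

/-- `β(t) = α - i e^{-2t(α+i)⁻¹} θ₂ θ₂* e^{-2t(α*-i)⁻¹} S⁻¹`, where `S = S₀(t)`. -/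
def beta {n m₂ : ℕ} (α S : Matrix (Fin n) (Fin n) ℂ) (θ₂ : Matrix (Fin n) (Fin m₂) ℂ)
    (t : ℝ) : Matrix (Fin n) (Fin n) ℂ :=
  α - Complex.I • (NormedSpace.exp ((-2 * t : ℂ) • (α + Complex.I • 1)⁻¹) * θ₂ * θ₂ᴴ
    * NormedSpace.exp ((-2 * t : ℂ) • (αᴴ - Complex.I • 1)⁻¹) * S⁻¹)

/-- `-i θ₁* e^{-2t(α*+i)⁻¹} S⁻¹ (z + β(t))⁻¹ e^{-2t(α+i)⁻¹} θ₂`, where `S = S₀(t)`. -/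
def weylFormula {n m₁ m₂ : ℕ} (α S : Matrix (Fin n) (Fin n) ℂ)
    (θ₁ : Matrix (Fin n) (Fin m₁) ℂ) (θ₂ : Matrix (Fin n) (Fin m₂) ℂ) (t : ℝ) (z : ℂ) :
    Matrix (Fin m₁) (Fin m₂) ℂ :=
  (-Complex.I) • (θ₁ᴴ * NormedSpace.exp ((-2 * t : ℂ) • (αᴴ + Complex.I • 1)⁻¹) * S⁻¹
    * (z • 1 + beta α S θ₂ t)⁻¹ * NormedSpace.exp ((-2 * t : ℂ) • (α + Complex.I • 1)⁻¹) * θ₂)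

end DGHM

end

namespace DGHM

/-! ### Block columns, controllable pairs and Lyapunov identities. -/

variable {n m m₁ m₂ : ℕ}

/-! For fixed `t` the system is a Bäcklund–Darboux transform of the trivial system `y_{k+1} = (I +
(i/z) j) y_k`. With the transfer function `w_k(z) = I - i Λ_k* S_k⁻¹ (z + α)⁻¹ Λ_k`,
`transfer_darboux` intertwines the two recursions, so the fundamental solution times `w_0` equals
`w_k (I + (i/z) j)^k`, the second factor being diagonal. The Lyapunov identity `α S_k - S_k α* = i
Λ_k Λ_k*` makes `w_k` contractive for `Im z > 0`.

Existence: the lower part of the trivial system is scaled by `(1 - i/z)^k`, which decays exactly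
when `Im z > 1/2`. Hence `w_0 [0; X]` generates a square summable solution; choosing `X` so that the
lower block is `I` and using the resolvent identity gives the formula with `β`.

Uniqueness: `tr Λ_k* S_k⁻¹ Λ_k = 2 Im tr α` for all `k`, so for `Im z ≥ 4 Im tr α` the `w_k` are
bounded below uniformly in `k`. The upper part is scaled by `(1 + i/z)^k`, of modulus at least one,
so summability forces it to vanish. The identity theorem then covers the whole half-plane.

Time dependence: `Λ(t)` is explicit. As `σ(α)` lies in the open upper half-plane, `X ↦ α X - X α*`
is invertible, and `S(t)` is the preimage of `i Λ(t) Λ(t)*`; differentiation yields its evolution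
equation. Positivity of `S(t)` for all `t` follows from `posDef_of_lyapunov`: nothing of the form
`S(t) + μ S₀`, `μ ≥ 0`, can be singular when `{α, θ₁(t)}` is controllable. -/

theorem mul_conjTranspose_eq_toCols (Λ : Matrix (Fin n) (Fin m₁ ⊕ Fin m₂) ℂ) :
    Λ * Λᴴ = Λ.toCols₁ * Λ.toCols₁ᴴ + Λ.toCols₂ * Λ.toCols₂ᴴ := by
  ext i k
  simp [Matrix.mul_apply, Fintype.sum_sum_type]

theorem mul_sig (Λ : Matrix (Fin n) (Fin m₁ ⊕ Fin m₂) ℂ) :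
    Λ * sig m₁ m₂ = Matrix.fromCols Λ.toCols₁ (-Λ.toCols₂) := by
  conv_lhs => rw [← Matrix.fromCols_toCols Λ, sig, Matrix.fromCols_mul_fromBlocks]
  simp

theorem mul_sig_mul_conjTranspose_eq_toCols (Λ : Matrix (Fin n) (Fin m₁ ⊕ Fin m₂) ℂ) :
    Λ * sig m₁ m₂ * Λᴴ = Λ.toCols₁ * Λ.toCols₁ᴴ - Λ.toCols₂ * Λ.toCols₂ᴴ := by
  rw [mul_sig]
  ext i k
  simp [Matrix.mul_apply, Fintype.sum_sum_type, sub_eq_add_neg]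

theorem sig_conjTranspose : (sig m₁ m₂)ᴴ = sig m₁ m₂ := by
  simp [sig, Matrix.fromBlocks_conjTranspose]

theorem sig_mul_sig : sig m₁ m₂ * sig m₁ m₂ = 1 := by
  simp [sig, Matrix.fromBlocks_multiply]

/-- Controllability is inherited by `E * θ` if `E` is invertible and commutes with `α`. -/
theorem IsControllable.mul_left {α E : Matrix (Fin n) (Fin n) ℂ} {θ : Matrix (Fin n) (Fin m) ℂ}
    (h : IsControllable α θ) (hE : IsUnit E) (hc : Commute α E) : IsControllable α (E * θ) := by
  unfold IsControllable at *
  have key : ∀ ν : Fin n, LinearMap.range (Matrix.mulVecLin (α ^ (ν : ℕ) * (E * θ))) =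
      (LinearMap.range (Matrix.mulVecLin (α ^ (ν : ℕ) * θ))).map (Matrix.mulVecLin E) := by
    intro ν
    rw [← LinearMap.range_comp, ← Matrix.mulVecLin_mul, ← Matrix.mul_assoc, ← Matrix.mul_assoc,
      (hc.pow_left ν).eq]
  simp_rw [key]
  rw [← Submodule.map_iSup, h, Submodule.map_top, LinearMap.range_eq_top]
  exact Matrix.mulVec_surjective_iff_isUnit.2 hE

/-- A row vector annihilating all `α ^ ν * θ` vanishes if `{α, θ}` is controllable. -/
theorem IsControllable.eq_zero_of_vecMul {α : Matrix (Fin n) (Fin n) ℂ}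
    {θ : Matrix (Fin n) (Fin m) ℂ} (h : IsControllable α θ) {v : Fin n → ℂ}
    (hv : ∀ ν : ℕ, v ᵥ* (α ^ ν * θ) = 0) : v = 0 := by
  have hle : (⊤ : Submodule ℂ (Fin n → ℂ)) ≤ LinearMap.ker (dotProductBilin ℂ ℂ v) := by
    rw [← h, iSup_le_iff]
    rintro ν _ ⟨x, rfl⟩
    simp [Matrix.dotProduct_mulVec, hv]
  refine dotProduct_eq_zero v fun w => ?_
  simpa using hle (Submodule.mem_top (x := w))

/-- A row vector annihilating `θ` and spanning an `α`-invariant line vanishes. -/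
theorem IsControllable.eq_zero_of_eigenvector {α : Matrix (Fin n) (Fin n) ℂ}
    {θ : Matrix (Fin n) (Fin m) ℂ} (h : IsControllable α θ) {v : Fin n → ℂ} {μ : ℂ}
    (hv : v ᵥ* α = μ • v) (hθ : v ᵥ* θ = 0) : v = 0 := by
  refine h.eq_zero_of_vecMul fun ν => ?_
  have : v ᵥ* α ^ ν = μ ^ ν • v := by
    induction ν with
    | zero => simp
    | succ k ih => rw [pow_succ, ← Matrix.vecMul_vecMul, ih, Matrix.smul_vecMul, hv, smul_smul,
        pow_succ]
  rw [← Matrix.vecMul_vecMul, this, Matrix.smul_vecMul, hθ, smul_zero]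

/-- A Hermitian solution of the Lyapunov identity of a controllable pair is nondegenerate. -/
theorem IsControllable.isUnit_of_lyapunov {α H G : Matrix (Fin n) (Fin n) ℂ}
    {θ : Matrix (Fin n) (Fin m) ℂ} (h : IsControllable α θ) (hH : H.IsHermitian)
    (hG : G.PosSemidef) (hl : α * H - H * αᴴ = Complex.I • (θ * θᴴ + G)) : IsUnit H := by
  rw [← Matrix.mulVec_injective_iff_isUnit, ← Matrix.coe_mulVecLin, ← LinearMap.ker_eq_bot,
    LinearMap.ker_eq_bot']
  intro v hv
  rw [Matrix.mulVecLin_apply] at hv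
  -- On `ker H` the quadratic form of the left side vanishes, so both nonnegative terms on the right
  -- do. Thus `ker H` is `αᴴ`-invariant and contained in `ker θᴴ`, which controllability excludes
  -- unless it is zero.
  have key : ∀ w, H *ᵥ w = 0 → θᴴ *ᵥ w = 0 ∧ H *ᵥ (αᴴ *ᵥ w) = 0 := by
    intro w hw
    have hw' : star w ᵥ* H = 0 := by
      rw [← hH.eq, ← Matrix.star_mulVec, hw, star_zero]
    have e1 : star w ⬝ᵥ ((α * H - H * αᴴ) *ᵥ w) = 0 := by
      rw [Matrix.sub_mulVec, dotProduct_sub, ← Matrix.mulVec_mulVec, hw, ← Matrix.mulVec_mulVec,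
        Matrix.dotProduct_mulVec _ H, hw']
      simp
    have e2 : star w ⬝ᵥ ((θ * θᴴ + G) *ᵥ w) = 0 := by
      rw [hl, Matrix.smul_mulVec, dotProduct_smul] at e1
      simpa using e1
    have p1 := (Matrix.posSemidef_self_mul_conjTranspose θ)
    have hz : (θ * θᴴ + G) *ᵥ w = 0 := ((p1.add hG).dotProduct_mulVec_zero_iff w).1 e2
    have hz1 : (θ * θᴴ) *ᵥ w = 0 := by
      refine (p1.dotProduct_mulVec_zero_iff w).1 ?_
      rw [Matrix.add_mulVec, dotProduct_add] at e2
      exact ((add_eq_zero_iff_of_nonneg (p1.dotProduct_mulVec_nonneg w)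
        (hG.dotProduct_mulVec_nonneg w)).1 e2).1
    refine ⟨?_, ?_⟩
    · exact (Matrix.self_mul_conjTranspose_mulVec_eq_zero θ w).1 hz1
    · have := congrArg (· *ᵥ w) hl
      simp only [Matrix.sub_mulVec, Matrix.smul_mulVec, hz, smul_zero,
        ← Matrix.mulVec_mulVec, hw, Matrix.mulVec_zero, zero_sub, neg_eq_zero] at this
      exact this
  have hker : ∀ ν : ℕ, H *ᵥ ((αᴴ ^ ν) *ᵥ v) = 0 := by
    intro ν
    induction ν with
    | zero => simpa using hv
    | succ k ih => rw [pow_succ', ← Matrix.mulVec_mulVec]; exact (key _ ih).2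
  have : star v = 0 := by
    refine h.eq_zero_of_vecMul fun ν => ?_
    have := (key _ (hker ν)).1
    rw [Matrix.mulVec_mulVec] at this
    have h2 := congrArg star this
    rw [Matrix.star_mulVec, star_zero] at h2
    simpa [Matrix.conjTranspose_mul, Matrix.conjTranspose_pow] using h2
  simpa using this

/-- If `H + μ S` is invertible for all `μ ≥ 0`, where `S > 0`,
then `H > 0`. -/
theorem posDef_of_isUnit_add_smul {S H : Matrix (Fin n) (Fin n) ℂ} (hS : S.PosDef)
    (hH : H.IsHermitian) (hu : ∀ μ : ℝ, 0 ≤ μ → IsUnit (H + (μ : ℂ) • S)) : H.PosDef := by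
  obtain ⟨B, hB, hSB⟩ : ∃ B : Matrix (Fin n) (Fin n) ℂ, IsUnit B ∧ S = Bᴴ * B := by
    open scoped MatrixOrder in
    obtain ⟨y, hy, h⟩ := CStarAlgebra.isStrictlyPositive_iff_eq_star_mul_self.mp
      hS.isStrictlyPositive
    exact ⟨y, hy, h⟩
  have hBd := (Matrix.isUnit_iff_isUnit_det _).1 hB
  have hBd' : IsUnit Bᴴ.det := by rw [Matrix.det_conjTranspose]; exact hBd.star
  -- The congruence turns `H + μ S` into `K + μ`; an eigenvalue `λ ≤ 0` of `K` would make it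
  -- singular at `μ = -λ ≥ 0`.
  set K := (B⁻¹)ᴴ * H * B⁻¹ with hK
  have hKh : K.IsHermitian := by
    simp [hK, Matrix.IsHermitian, Matrix.conjTranspose_mul, hH.eq, Matrix.mul_assoc]
  have hHK : H = Bᴴ * K * B := by
    rw [hK, Matrix.conjTranspose_nonsing_inv]
    simp only [Matrix.mul_assoc, Matrix.nonsing_inv_mul _ hBd, Matrix.mul_one]
    rw [Matrix.mul_nonsing_inv_cancel_left _ _ hBd']
  have hKp : K.PosDef := by
    rw [hKh.posDef_iff_eigenvalues_pos]
    by_contra! hcon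
    obtain ⟨i, hi⟩ := hcon
    have hu' := hu (-hKh.eigenvalues i) (by linarith)
    have e : H + ((-hKh.eigenvalues i : ℝ) : ℂ) • S
        = Bᴴ * (K - (hKh.eigenvalues i : ℂ) • 1) * B := by
      rw [hHK, hSB]
      rw [Matrix.mul_sub, Matrix.sub_mul, Matrix.mul_smul, Matrix.mul_one, Matrix.smul_mul,
        Complex.ofReal_neg, neg_smul, sub_eq_add_neg]
    rw [e, Matrix.isUnit_iff_isUnit_det, Matrix.det_mul, Matrix.det_mul] at hu'
    have hd := isUnit_of_mul_isUnit_right (isUnit_of_mul_isUnit_left hu')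
    refine hd.ne_zero (Matrix.exists_mulVec_eq_zero_iff.1 ⟨hKh.eigenvectorBasis i, ?_, ?_⟩)
    · have := (hKh.eigenvectorBasis.orthonormal.ne_zero i)
      simpa using this
    · rw [Matrix.sub_mulVec, hKh.mulVec_eigenvectorBasis, Matrix.smul_mulVec, Matrix.one_mulVec]
      simp
  rw [hHK]
  exact (Matrix.IsUnit.posDef_star_left_conjugate_iff hB).2 hKp

/-- A known positive solution `S` serves as a reference: each `H + μ S` with `μ ≥ 0` satisfies a
Lyapunov identity with the same `θ` and a larger `G`, hence is invertible. -/
theorem posDef_of_lyapunov {α S H : Matrix (Fin n) (Fin n) ℂ} {Q : Matrix (Fin n) (Fin n) ℂ}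
    {θ : Matrix (Fin n) (Fin m) ℂ} {G : Matrix (Fin n) (Fin n) ℂ} (hS : S.PosDef)
    (hQ : Q.PosSemidef) (hSl : α * S - S * αᴴ = Complex.I • Q) (h : IsControllable α θ)
    (hH : H.IsHermitian) (hG : G.PosSemidef)
    (hl : α * H - H * αᴴ = Complex.I • (θ * θᴴ + G)) : H.PosDef := by
  refine posDef_of_isUnit_add_smul hS hH fun μ hμ => ?_
  have hμ' : (0 : ℂ) ≤ μ := by exact_mod_cast hμ
  refine h.isUnit_of_lyapunov (G := G + (μ : ℂ) • Q) (hH.add (hS.posSemidef.smul hμ').isHermitian)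
    (hG.add (hQ.smul hμ')) ?_
  have : α * (H + (μ : ℂ) • S) - (H + (μ : ℂ) • S) * αᴴ
      = (α * H - H * αᴴ) + (μ : ℂ) • (α * S - S * αᴴ) := by
    simp [Matrix.mul_add, Matrix.add_mul, smul_sub]; abel
  rw [this, hl, hSl]
  module

theorem sub_smul_isUnit_of_notMem_spectrum {α : Matrix (Fin n) (Fin n) ℂ} {μ : ℂ}
    (h : μ ∉ spectrum ℂ α) : IsUnit (α - μ • 1) := by
  rw [spectrum.notMem_iff, Algebra.algebraMap_eq_smul_one] at h
  simpa using h.neg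

/-- The spectrum of `α` lies in the open upper half-plane. -/
theorem IsStronglyAdmissible.im_pos {α S : Matrix (Fin n) (Fin n) ℂ}
    {θ₁ : Matrix (Fin n) (Fin m₁) ℂ} {θ₂ : Matrix (Fin n) (Fin m₂) ℂ}
    (h : IsStronglyAdmissible α S θ₁ θ₂) {μ : ℂ} (hμ : μ ∈ spectrum ℂ α) : 0 < μ.im := by
  obtain ⟨⟨hS, hl⟩, hc⟩ := h
  rw [spectrum.mem_iff, Algebra.algebraMap_eq_smul_one, Matrix.isUnit_iff_isUnit_det,
    isUnit_iff_ne_zero, not_not, ← Matrix.exists_vecMul_eq_zero_iff] at hμ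
  obtain ⟨v, hv0, hv⟩ := hμ
  have hv : v ᵥ* α = μ • v := by
    rw [Matrix.vecMul_sub, sub_eq_zero, Matrix.vecMul_smul, Matrix.vecMul_one] at hv
    exact hv.symm
  have hθ : v ᵥ* θ₁ ≠ 0 := fun h0 => hv0 (hc.eq_zero_of_eigenvector hv h0)
  have hv' : αᴴ *ᵥ star v = star μ • star v := by
    rw [← Matrix.star_vecMul, hv, star_smul]
  -- A left eigenvector turns the Lyapunov identity into `2 i (Im μ) (v S v*) = i (|v θ₁|² + |v
  -- θ₂|²)`.
  have e1 : v ⬝ᵥ ((α * S - S * αᴴ) *ᵥ star v) = (μ - star μ) * (v ⬝ᵥ (S *ᵥ star v)) := by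
    rw [Matrix.sub_mulVec, dotProduct_sub, ← Matrix.mulVec_mulVec, ← Matrix.mulVec_mulVec, hv',
      Matrix.dotProduct_mulVec _ α, hv, Matrix.mulVec_smul]
    simp only [smul_dotProduct, dotProduct_smul, smul_eq_mul]
    ring
  have pS := hS.dotProduct_mulVec_pos (x := star v) (by simpa using hv0)
  have p1 : 0 < v ⬝ᵥ ((θ₁ * θ₁ᴴ) *ᵥ star v) := by
    rw [← Matrix.mulVec_mulVec, Matrix.dotProduct_mulVec, ← Matrix.star_vecMul]
    exact Matrix.dotProduct_self_star_pos_iff.2 hθ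
  have p2 : 0 ≤ v ⬝ᵥ ((θ₂ * θ₂ᴴ) *ᵥ star v) := by
    rw [← Matrix.mulVec_mulVec, Matrix.dotProduct_mulVec, ← Matrix.star_vecMul]
    exact dotProduct_self_star_nonneg _
  have p := add_pos_of_pos_of_nonneg p1 p2
  rw [hl, Matrix.smul_mulVec, dotProduct_smul, Matrix.add_mulVec, dotProduct_add] at e1
  rw [star_star] at pS
  generalize v ⬝ᵥ ((θ₁ * θ₁ᴴ) *ᵥ star v) + v ⬝ᵥ ((θ₂ * θ₂ᴴ) *ᵥ star v) = a at *
  generalize v ⬝ᵥ (S *ᵥ star v) = s at *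
  obtain ⟨ha, ha'⟩ := Complex.lt_def.1 p
  obtain ⟨hs, hs'⟩ := Complex.lt_def.1 pS
  have := congrArg Complex.im e1
  simp at this ha ha' hs hs'
  nlinarith

/-- A Sylvester equation with disjoint spectra has at most one solution. -/
theorem eq_zero_of_sylvester {α γ X : Matrix (Fin n) (Fin n) ℂ}
    (hd : ∀ μ ∈ spectrum ℂ α, μ ∉ spectrum ℂ γ) (hX : α * X = X * γ) : X = 0 := by
  have hsemi : ∀ p : Polynomial ℂ, Polynomial.aeval α p * X = X * Polynomial.aeval γ p := by
    intro p
    have hpow : ∀ k : ℕ, α ^ k * X = X * γ ^ k := by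
      intro k
      exact (SemiconjBy.pow_right (show SemiconjBy X γ α from hX.symm) k).eq.symm
    induction p using Polynomial.induction_on' with
    | add p q hp hq => simp [Matrix.add_mul, Matrix.mul_add, hp, hq]
    | monomial k a =>
      simp [Polynomial.aeval_monomial, ← Algebra.smul_def, hpow]
  -- Cayley–Hamilton gives `X p(γ) = 0` for `p` the characteristic polynomial of `α`; by spectral
  -- mapping `p(γ)` is invertible, since no eigenvalue of `γ` is a root of `p`.
  have h0 := hsemi α.charpoly
  rw [Matrix.aeval_self_charpoly, Matrix.zero_mul] at h0
  have hu : IsUnit (Polynomial.aeval γ α.charpoly) := by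
    rcases Nat.eq_zero_or_pos n with rfl | hn
    · exact isUnit_of_subsingleton _
    have hdeg : 0 < α.charpoly.degree := by
      rw [Matrix.charpoly_degree_eq_dim]; simpa using hn
    by_contra hcon
    rw [← spectrum.zero_mem_iff ℂ, spectrum.map_polynomial_aeval_of_degree_pos _ _ hdeg] at hcon
    obtain ⟨μ, hμ, hr⟩ := hcon
    exact hd μ (Matrix.mem_spectrum_iff_isRoot_charpoly.2 hr) hμ
  exact (hu.mul_left_eq_zero).1 h0.symm

theorem mem_spectrum_conjTranspose {α : Matrix (Fin n) (Fin n) ℂ} {μ : ℂ} :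
    μ ∈ spectrum ℂ αᴴ ↔ star μ ∈ spectrum ℂ α := by
  rw [← Matrix.star_eq_conjTranspose, spectrum.map_star, Set.mem_star]

/-! ### Invertibility from the location of the spectrum. -/

section Units

variable {α S : Matrix (Fin n) (Fin n) ℂ} {θ₁ : Matrix (Fin n) (Fin m₁) ℂ}
  {θ₂ : Matrix (Fin n) (Fin m₂) ℂ}

/-- `z + α` is invertible for `z` in the closed upper half-plane. -/
theorem IsStronglyAdmissible.isUnit_smul_one_add (h : IsStronglyAdmissible α S θ₁ θ₂) {z : ℂ}
    (hz : 0 ≤ z.im) : IsUnit (z • 1 + α) := by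
  have : -z ∉ spectrum ℂ α := fun hm => by
    have := h.im_pos hm
    simp at this
    linarith
  simpa [sub_eq_add_neg, add_comm] using sub_smul_isUnit_of_notMem_spectrum this

theorem IsStronglyAdmissible.isUnit (h : IsStronglyAdmissible α S θ₁ θ₂) : IsUnit α := by
  simpa using h.isUnit_smul_one_add (z := 0) (by simp)

theorem IsStronglyAdmissible.isUnit_add_I (h : IsStronglyAdmissible α S θ₁ θ₂) :
    IsUnit (α + Complex.I • 1) := by
  simpa [add_comm] using h.isUnit_smul_one_add (z := Complex.I) (by simp)

end Units

/-! ### One step of the recursion preserves strong admissibility. -/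

section Step

variable {α S : Matrix (Fin n) (Fin n) ℂ} {Λ : Matrix (Fin n) (Fin m₁ ⊕ Fin m₂) ℂ}

theorem isStronglyAdmissible_toCols_iff :
    IsStronglyAdmissible α S Λ.toCols₁ Λ.toCols₂ ↔
      S.PosDef ∧ α * S - S * αᴴ = Complex.I • (Λ * Λᴴ) ∧ IsControllable α Λ.toCols₁ := by
  rw [IsStronglyAdmissible, IsAdmissible, mul_conjTranspose_eq_toCols, and_assoc]

/-- One step `Λ ↦ Λ + i α⁻¹ Λ j` of the recursion. -/
noncomputable def lamNext (α : Matrix (Fin n) (Fin n) ℂ) (Λ : Matrix (Fin n) (Fin m₁ ⊕ Fin m₂) ℂ) :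
    Matrix (Fin n) (Fin m₁ ⊕ Fin m₂) ℂ :=
  Λ + Complex.I • (α⁻¹ * Λ * sig m₁ m₂)

/-- One step `S ↦ S + α⁻¹ S α⁻* + α⁻¹ Λ j Λ* α⁻*` of the recursion. -/
noncomputable def SNext (α S : Matrix (Fin n) (Fin n) ℂ) (Λ : Matrix (Fin n) (Fin m₁ ⊕ Fin m₂) ℂ) :
    Matrix (Fin n) (Fin n) ℂ :=
  S + α⁻¹ * S * (α⁻¹)ᴴ + α⁻¹ * Λ * sig m₁ m₂ * Λᴴ * (α⁻¹)ᴴ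

theorem toCols₁_lamNext : (lamNext α Λ).toCols₁ = (1 + Complex.I • α⁻¹) * Λ.toCols₁ := by
  rw [lamNext, mul_sig, Matrix.add_mul, Matrix.one_mul, Matrix.smul_mul]
  ext i j
  simp [Matrix.mul_apply]

theorem conjTranspose_inv_mul_cancel (hα : IsUnit α) : (α⁻¹)ᴴ * αᴴ = 1 := by
  rw [← Matrix.conjTranspose_mul,
    Matrix.mul_nonsing_inv _ ((Matrix.isUnit_iff_isUnit_det _).1 hα), Matrix.conjTranspose_one]

/-- A one-sided form of the Lyapunov identity. Subtracting it from its adjoint gives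
`SNext_lyapunov`, and it drives `lamNext_identity`. -/
theorem SNext_mul_conjTranspose (hα : IsUnit α)
    (hl : α * S - S * αᴴ = Complex.I • (Λ * Λᴴ)) :
    SNext α S Λ * αᴴ = (α + α⁻¹) * S - Complex.I • (lamNext α Λ * Λᴴ) := by
  have h1 := conjTranspose_inv_mul_cancel hα
  have h2 : S * αᴴ = α * S - Complex.I • (Λ * Λᴴ) := by rw [← hl]; abel
  simp only [SNext, lamNext, Matrix.add_mul, Matrix.mul_assoc, h1, h2, Matrix.mul_one,
    Matrix.smul_mul, smul_add, smul_smul, Complex.I_mul_I]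
  module

theorem SNext_isHermitian (hS : S.IsHermitian) : (SNext α S Λ).IsHermitian := by
  simp [SNext, Matrix.IsHermitian, Matrix.conjTranspose_add, Matrix.conjTranspose_mul, hS.eq,
    sig_conjTranspose, Matrix.mul_assoc]

theorem SNext_lyapunov (hα : IsUnit α) (hS : S.IsHermitian)
    (hl : α * S - S * αᴴ = Complex.I • (Λ * Λᴴ)) :
    α * SNext α S Λ - SNext α S Λ * αᴴ = Complex.I • (lamNext α Λ * (lamNext α Λ)ᴴ) := by
  have e1 := SNext_mul_conjTranspose hα hl
  have e2 := congrArg Matrix.conjTranspose e1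
  rw [Matrix.conjTranspose_mul, (SNext_isHermitian hS).eq, Matrix.conjTranspose_conjTranspose]
    at e2
  rw [e1, e2]
  have h3 : α⁻¹ * α = 1 := Matrix.nonsing_inv_mul _ ((Matrix.isUnit_iff_isUnit_det _).1 hα)
  have h4 := congrArg Matrix.conjTranspose h3
  rw [Matrix.conjTranspose_mul, Matrix.conjTranspose_one] at h4
  -- The Lyapunov identity conjugated by `α⁻¹`; it absorbs the terms in `α⁻¹ * S` left over by the
  -- subtraction.
  have e3 : S * (α⁻¹)ᴴ - α⁻¹ * S = Complex.I • (α⁻¹ * (Λ * (Λᴴ * (α⁻¹)ᴴ))) := by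
    have := congrArg (fun Y => α⁻¹ * Y * (α⁻¹)ᴴ) hl
    simp only [Matrix.mul_sub, Matrix.sub_mul, Matrix.mul_assoc, h4, Matrix.mul_one,
      Matrix.mul_smul, Matrix.smul_mul] at this
    rw [← this, ← Matrix.mul_assoc, h3, Matrix.one_mul]
  have e4 : Λ * sig m₁ m₂ * (Λ * sig m₁ m₂)ᴴ = Λ * Λᴴ := by
    rw [Matrix.conjTranspose_mul, sig_conjTranspose, Matrix.mul_assoc, ← Matrix.mul_assoc (sig _ _),
      sig_mul_sig, Matrix.one_mul]
  have e5 : lamNext α Λ * (lamNext α Λ)ᴴ = Λ * (lamNext α Λ)ᴴ + lamNext α Λ * Λᴴ - Λ * Λᴴ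
      + α⁻¹ * (Λ * (Λᴴ * (α⁻¹)ᴴ)) := by
    have : α⁻¹ * (Λ * (Λᴴ * (α⁻¹)ᴴ)) = (lamNext α Λ - Λ) * (lamNext α Λ - Λ)ᴴ := by
      rw [← Matrix.mul_assoc Λ, ← e4]
      simp [lamNext, Matrix.conjTranspose_mul, Matrix.mul_assoc, smul_smul]
    rw [this, Matrix.conjTranspose_sub]
    simp only [Matrix.mul_sub, Matrix.sub_mul]
    abel
  rw [e5]
  simp only [Matrix.conjTranspose_sub, Matrix.conjTranspose_mul, Matrix.conjTranspose_add,
    Matrix.conjTranspose_smul, Matrix.conjTranspose_conjTranspose, hS.eq, Complex.star_def,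
    Complex.conj_I, Matrix.add_mul]
  linear_combination (norm := module) e3 - hl

/-- The cross terms of the square contribute `-α⁻¹ Λ Λ* α⁻*` by the Lyapunov identity, and twice the
first block restores the indefinite term `α⁻¹ Λ j Λ* α⁻*`. Positivity is then visible: `1 - i α⁻¹`
is invertible because `i` is not in the spectrum. -/
theorem SNext_eq (hα : IsUnit α) (hl : α * S - S * αᴴ = Complex.I • (Λ * Λᴴ)) :
    SNext α S Λ = (1 - Complex.I • α⁻¹) * S * (1 - Complex.I • α⁻¹)ᴴ
      + (2 : ℂ) • ((α⁻¹ * Λ.toCols₁) * (α⁻¹ * Λ.toCols₁)ᴴ) := by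
  have h3 : α⁻¹ * α = 1 := Matrix.nonsing_inv_mul _ ((Matrix.isUnit_iff_isUnit_det _).1 hα)
  have h4 := congrArg Matrix.conjTranspose h3
  rw [Matrix.conjTranspose_mul, Matrix.conjTranspose_one] at h4
  have e3 : S * (α⁻¹)ᴴ - α⁻¹ * S = Complex.I • (α⁻¹ * (Λ * Λᴴ) * (α⁻¹)ᴴ) := by
    have := congrArg (fun Y => α⁻¹ * Y * (α⁻¹)ᴴ) hl
    simp only [Matrix.mul_sub, Matrix.sub_mul, Matrix.mul_assoc, h4, Matrix.mul_one,
      Matrix.mul_smul, Matrix.smul_mul] at this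
    simp only [Matrix.mul_assoc]
    rw [← this, ← Matrix.mul_assoc, h3, Matrix.one_mul]
  have e4 : α⁻¹ * Λ * sig m₁ m₂ * Λᴴ * (α⁻¹)ᴴ = α⁻¹ * (Λ * sig m₁ m₂ * Λᴴ) * (α⁻¹)ᴴ := by
    simp only [Matrix.mul_assoc]
  rw [mul_conjTranspose_eq_toCols] at e3
  rw [SNext, e4, mul_sig_mul_conjTranspose_eq_toCols]
  simp only [Matrix.mul_add, Matrix.mul_sub, Matrix.add_mul, Matrix.sub_mul,
    Matrix.conjTranspose_sub, Matrix.conjTranspose_one, Matrix.conjTranspose_smul,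
    Matrix.conjTranspose_mul, Complex.star_def, Complex.conj_I, Matrix.mul_one, Matrix.one_mul,
    Matrix.smul_mul, Matrix.mul_smul, Matrix.mul_assoc, smul_sub, smul_add, smul_smul, mul_neg,
    Complex.I_mul_I, neg_smul] at e3 ⊢
  have e5 := congrArg (Complex.I • ·) e3
  simp only [smul_sub, smul_add, smul_smul, Complex.I_mul_I] at e5
  linear_combination (norm := module) (-1 : ℂ) • e5

/-- The recursion preserves strong admissibility. -/
theorem IsStronglyAdmissible.next (h : IsStronglyAdmissible α S Λ.toCols₁ Λ.toCols₂)
    (hi : Complex.I ∉ spectrum ℂ α) :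
    IsStronglyAdmissible α (SNext α S Λ) (lamNext α Λ).toCols₁ (lamNext α Λ).toCols₂ := by
  have hα := h.isUnit
  have hαI := h.isUnit_add_I
  have hαI' := sub_smul_isUnit_of_notMem_spectrum hi
  have hαd := (Matrix.isUnit_iff_isUnit_det _).1 hα
  obtain ⟨hS, hl, hc⟩ := isStronglyAdmissible_toCols_iff.1 h
  have u1 : IsUnit (1 - Complex.I • α⁻¹) := by
    have : 1 - Complex.I • α⁻¹ = α⁻¹ * (α - Complex.I • 1) := by
      simp [Matrix.mul_sub, Matrix.nonsing_inv_mul _ hαd]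
    rw [this]
    exact ((Matrix.isUnit_nonsing_inv_iff).2 hα).mul hαI'
  have u2 : IsUnit (1 + Complex.I • α⁻¹) := by
    have : 1 + Complex.I • α⁻¹ = α⁻¹ * (α + Complex.I • 1) := by
      simp [Matrix.mul_add, Matrix.nonsing_inv_mul _ hαd]
    rw [this]
    exact ((Matrix.isUnit_nonsing_inv_iff).2 hα).mul hαI
  refine isStronglyAdmissible_toCols_iff.2 ⟨?_, SNext_lyapunov hα hS.isHermitian hl, ?_⟩
  · rw [SNext_eq hα hl]
    exact ((Matrix.IsUnit.posDef_star_right_conjugate_iff u1).2 hS).add_posSemidef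
      ((Matrix.posSemidef_self_mul_conjTranspose _).smul (by norm_num))
  · rw [toCols₁_lamNext]
    refine hc.mul_left u2 ?_
    refine (Commute.one_right _).add_right (Commute.smul_right ?_ _)
    rw [Commute, SemiconjBy, Matrix.nonsing_inv_mul _ hαd, Matrix.mul_nonsing_inv _ hαd]

theorem IsStronglyAdmissible.seq (h : IsStronglyAdmissible α S Λ.toCols₁ Λ.toCols₂)
    (hi : Complex.I ∉ spectrum ℂ α) (k : ℕ) :
    IsStronglyAdmissible α (SSeq α Λ S k) (lamSeq α Λ k).toCols₁ (lamSeq α Λ k).toCols₂ := by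
  induction k with
  | zero => exact h
  | succ k ih => exact ih.next hi

end Step

/-! ### The transfer function and the Darboux transformation. -/

section Transfer

variable {α S : Matrix (Fin n) (Fin n) ℂ} {Λ : Matrix (Fin n) (Fin m₁ ⊕ Fin m₂) ℂ}

/-- The transfer matrix function `I - i Λ* S⁻¹ (α + z)⁻¹ Λ`. -/
noncomputable def transfer (α S : Matrix (Fin n) (Fin n) ℂ)
    (Λ : Matrix (Fin n) (Fin m₁ ⊕ Fin m₂) ℂ) (z : ℂ) :
    Matrix (Fin m₁ ⊕ Fin m₂) (Fin m₁ ⊕ Fin m₂) ℂ :=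
  1 - Complex.I • (Λᴴ * S⁻¹ * (z • 1 + α)⁻¹ * Λ)

/-- The Lyapunov identity sandwiched between resolvents. The transfer matrix is contractive for `Im
z ≥ 0` and unitary for real `z`; both facts are used. -/
theorem transfer_conjTranspose_mul_self (hS : S.PosDef)
    (hl : α * S - S * αᴴ = Complex.I • (Λ * Λᴴ)) {z : ℂ} (hz : IsUnit (z • 1 + α)) :
    (transfer α S Λ z)ᴴ * transfer α S Λ z
      = 1 - (2 * z.im : ℂ) • (((z • 1 + α)⁻¹ * Λ)ᴴ * S⁻¹ * ((z • 1 + α)⁻¹ * Λ)) := by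
  have hSd := (Matrix.isUnit_iff_isUnit_det _).1 hS.isUnit
  have hzd := (Matrix.isUnit_iff_isUnit_det _).1 hz
  set R := (z • 1 + α)⁻¹ with hR
  have hSi : (S⁻¹)ᴴ = S⁻¹ := hS.inv.isHermitian.eq
  have r1 : (z • 1 + α) * R = 1 := Matrix.mul_nonsing_inv _ hzd
  have r2 : Rᴴ * (z • 1 + α)ᴴ = 1 := by rw [← Matrix.conjTranspose_mul, r1,
    Matrix.conjTranspose_one]
  have l1 : S⁻¹ * α - αᴴ * S⁻¹ = Complex.I • (S⁻¹ * (Λ * Λᴴ) * S⁻¹) := by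
    have := congrArg (fun Y => S⁻¹ * Y * S⁻¹) hl
    simp only [Matrix.mul_sub, Matrix.sub_mul, Matrix.mul_smul, Matrix.smul_mul,
      Matrix.mul_assoc, Matrix.mul_nonsing_inv _ hSd, Matrix.mul_one,
      Matrix.nonsing_inv_mul_cancel_left _ _ hSd] at this
    simpa only [Matrix.mul_assoc] using this
  have hzz : z - star z = 2 * z.im * Complex.I := by
    apply Complex.ext <;> simp; ring
  have l2 : S⁻¹ * (z • 1 + α) - (z • 1 + α)ᴴ * S⁻¹
      = Complex.I • (S⁻¹ * (Λ * Λᴴ) * S⁻¹) + (2 * z.im * Complex.I) • S⁻¹ := by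
    rw [← l1, ← hzz]
    simp only [Matrix.conjTranspose_add, Matrix.conjTranspose_smul, Matrix.conjTranspose_one,
      Matrix.mul_add, Matrix.add_mul, Matrix.mul_smul, Matrix.smul_mul, Matrix.mul_one,
      Matrix.one_mul]
    module
  have l3 : Rᴴ * S⁻¹ - S⁻¹ * R
      = Complex.I • (Rᴴ * (S⁻¹ * (Λ * (Λᴴ * (S⁻¹ * R)))))
        + (2 * z.im * Complex.I) • (Rᴴ * (S⁻¹ * R)) := by
    have := congrArg (fun Y => Rᴴ * Y * R) l2
    simp only [Matrix.mul_sub, Matrix.sub_mul] at this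
    rw [show Rᴴ * (S⁻¹ * (z • 1 + α)) * R = Rᴴ * S⁻¹ * ((z • 1 + α) * R) by
        simp only [Matrix.mul_assoc], show Rᴴ * ((z • 1 + α)ᴴ * S⁻¹) * R
          = (Rᴴ * (z • 1 + α)ᴴ) * (S⁻¹ * R) by simp only [Matrix.mul_assoc], r1, r2,
      Matrix.mul_one, Matrix.one_mul] at this
    rw [this]
    simp only [Matrix.mul_add, Matrix.add_mul, Matrix.mul_smul, Matrix.smul_mul, Matrix.mul_assoc]
  have l4 := congrArg (fun Y => Λᴴ * Y * Λ) l3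
  simp only [Matrix.mul_add, Matrix.add_mul, Matrix.mul_sub, Matrix.sub_mul, Matrix.mul_smul,
    Matrix.smul_mul, Matrix.mul_assoc] at l4
  simp only [transfer, ← hR, Matrix.conjTranspose_sub, Matrix.conjTranspose_one,
    Matrix.conjTranspose_smul, Matrix.conjTranspose_mul, Matrix.conjTranspose_conjTranspose, hSi,
    Complex.star_def, Complex.conj_I, Matrix.mul_sub, Matrix.sub_mul, Matrix.mul_one,
    Matrix.one_mul, Matrix.mul_smul, Matrix.smul_mul, Matrix.mul_assoc, smul_smul, smul_sub,
    mul_neg, Complex.I_mul_I]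
  have l5 := congrArg (Complex.I • ·) l4
  simp only [smul_sub, smul_add, smul_smul, Complex.I_mul_I,
    show Complex.I * (2 * z.im * Complex.I) = -(2 * z.im) by
      linear_combination (2 * z.im : ℂ) * Complex.I_mul_I] at l5
  linear_combination (norm := module) l5

/-- The key identity behind the Bäcklund–Darboux transformation of the trivial system. -/
theorem lamNext_identity (hα : IsUnit α) (hS : S.PosDef) (hS' : (SNext α S Λ).PosDef)
    (hl : α * S - S * αᴴ = Complex.I • (Λ * Λᴴ)) :
    Complex.I • ((lamNext α Λ)ᴴ * (SNext α S Λ)⁻¹ * (α + α⁻¹))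
      = Complex.I • (Λᴴ * S⁻¹ * α)
        + (sig m₁ m₂ + Λᴴ * S⁻¹ * Λ - (lamNext α Λ)ᴴ * (SNext α S Λ)⁻¹ * lamNext α Λ)
          * (Λᴴ * S⁻¹) := by
  have hSd := (Matrix.isUnit_iff_isUnit_det _).1 hS.isUnit
  have hSd' := (Matrix.isUnit_iff_isUnit_det _).1 hS'.isUnit
  have h4 := conjTranspose_inv_mul_cancel hα
  have e1 := SNext_mul_conjTranspose hα hl
  have e2 : (lamNext α Λ)ᴴ * αᴴ = Λᴴ * αᴴ - Complex.I • (sig m₁ m₂ * Λᴴ) := by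
    simp only [lamNext, Matrix.conjTranspose_add, Matrix.conjTranspose_smul,
      Matrix.conjTranspose_mul, sig_conjTranspose, Matrix.add_mul, Matrix.smul_mul,
      Matrix.mul_assoc, h4, Matrix.mul_one, Complex.star_def, Complex.conj_I]
    module
  have e3 : (lamNext α Λ)ᴴ * (αᴴ * S⁻¹)
      = (lamNext α Λ)ᴴ * (SNext α S Λ)⁻¹ * (α + α⁻¹)
        - Complex.I • ((lamNext α Λ)ᴴ * (SNext α S Λ)⁻¹ * (lamNext α Λ * (Λᴴ * S⁻¹))) := by
    have := congrArg (fun Y => (lamNext α Λ)ᴴ * (SNext α S Λ)⁻¹ * (Y * S⁻¹)) e1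
    simp only [Matrix.mul_sub, Matrix.sub_mul, Matrix.mul_smul, Matrix.smul_mul,
      Matrix.mul_assoc, Matrix.nonsing_inv_mul_cancel_left _ _ hSd',
      Matrix.mul_nonsing_inv _ hSd, Matrix.mul_one] at this
    simpa only [Matrix.mul_assoc] using this
  have e4 : S⁻¹ * (Λ * (Λᴴ * S⁻¹)) = -(Complex.I • (S⁻¹ * α)) + Complex.I • (αᴴ * S⁻¹) := by
    have := congrArg (fun Y => Complex.I • (S⁻¹ * Y * S⁻¹)) hl
    simp only [Matrix.mul_sub, Matrix.sub_mul, Matrix.mul_smul, Matrix.smul_mul,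
      Matrix.mul_assoc, Matrix.mul_nonsing_inv _ hSd, Matrix.mul_one, smul_smul, smul_sub,
      Complex.I_mul_I, Matrix.nonsing_inv_mul_cancel_left _ _ hSd] at this
    linear_combination (norm := module) this
  have e5 : Λᴴ * (αᴴ * S⁻¹) = (lamNext α Λ)ᴴ * (αᴴ * S⁻¹)
      + Complex.I • (sig m₁ m₂ * (Λᴴ * S⁻¹)) := by
    rw [← Matrix.mul_assoc (lamNext α Λ)ᴴ αᴴ, e2]
    simp only [Matrix.sub_mul, Matrix.smul_mul, Matrix.mul_assoc]
    abel
  have e6 := e5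
  rw [e3] at e6
  have e7 := congrArg (Complex.I • ·) e6
  simp only [Matrix.sub_mul, Matrix.add_mul, Matrix.mul_assoc, e4, Matrix.mul_add, Matrix.mul_neg,
    Matrix.mul_smul, smul_add, smul_sub, smul_smul, Complex.I_mul_I] at e7 ⊢
  linear_combination (norm := module) -e7

/-- Bäcklund–Darboux transformation of the trivial system `y_{k+1} = (I + (i/z) j) y_k`. -/
theorem transfer_darboux (hα : IsUnit α) (hS : S.PosDef) (hS' : (SNext α S Λ).PosDef)
    (hl : α * S - S * αᴴ = Complex.I • (Λ * Λᴴ)) {z : ℂ} (hz0 : z ≠ 0)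
    (hz : IsUnit (z • 1 + α)) :
    transfer α (SNext α S Λ) (lamNext α Λ) z * (1 + (Complex.I / z) • sig m₁ m₂)
      = (1 + (Complex.I / z) • (sig m₁ m₂ + Λᴴ * S⁻¹ * Λ
          - (lamNext α Λ)ᴴ * (SNext α S Λ)⁻¹ * lamNext α Λ)) * transfer α S Λ z := by
  have hzd := (Matrix.isUnit_iff_isUnit_det _).1 hz
  have hαd := (Matrix.isUnit_iff_isUnit_det _).1 hα
  have key := lamNext_identity hα hS hS' hl
  set R := (z • 1 + α)⁻¹ with hR
  set C := sig m₁ m₂ + Λᴴ * S⁻¹ * Λ - (lamNext α Λ)ᴴ * (SNext α S Λ)⁻¹ * lamNext α Λ with hC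
  set T := (lamNext α Λ)ᴴ * (SNext α S Λ)⁻¹ with hT
  have hRα : α * R = 1 - z • R := by
    have : (z • 1 + α) * R = 1 := Matrix.mul_nonsing_inv _ hzd
    rw [← this, Matrix.add_mul, Matrix.smul_mul, Matrix.one_mul]; abel
  have hRα' : R * α = 1 - z • R := by
    have : R * (z • 1 + α) = 1 := Matrix.nonsing_inv_mul _ hzd
    rw [← this, Matrix.mul_add, Matrix.mul_smul, Matrix.mul_one]; abel
  have hcomm : R * α⁻¹ = α⁻¹ * R := by
    have : α⁻¹ * (α * R) * α⁻¹ = α⁻¹ * (R * α) * α⁻¹ := by rw [hRα, hRα']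
    rw [Matrix.nonsing_inv_mul_cancel_left _ _ hαd, Matrix.mul_assoc α⁻¹, Matrix.mul_assoc R,
      Matrix.mul_nonsing_inv _ hαd, Matrix.mul_one] at this
    exact this
  -- `(α - i j) Λ' = (α + α⁻¹) Λ`
  have e1 : α * lamNext α Λ - Complex.I • (lamNext α Λ * sig m₁ m₂) = (α + α⁻¹) * Λ := by
    simp only [lamNext, Matrix.mul_add, Matrix.add_mul, Matrix.mul_smul, Matrix.smul_mul,
      Matrix.mul_assoc, sig_mul_sig, Matrix.mul_one, Matrix.mul_nonsing_inv_cancel_left _ _ hαd,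
      smul_add, smul_smul, Complex.I_mul_I]
    module
  have e2 : T * R * (α * lamNext α Λ - Complex.I • (lamNext α Λ * sig m₁ m₂))
      = T * (α + α⁻¹) * R * Λ := by
    rw [e1]
    simp only [Matrix.mul_add, Matrix.add_mul, Matrix.mul_assoc]
    rw [← Matrix.mul_assoc R, hRα', ← hRα, ← Matrix.mul_assoc R, hcomm]
    simp only [Matrix.mul_assoc]
  have e3 := congrArg (fun Y => Y * (R * Λ)) key
  have e4 := congrArg (Complex.I • ·) e2
  have hCj : sig m₁ m₂ = C - Λᴴ * S⁻¹ * Λ + T * lamNext α Λ := by rw [hC]; abel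
  have e5 : α * (R * Λ) = Λ - z • (R * Λ) := by
    rw [← Matrix.mul_assoc, hRα, Matrix.sub_mul, Matrix.one_mul, Matrix.smul_mul]
  have e6 : R * (α * lamNext α Λ) = lamNext α Λ - z • (R * lamNext α Λ) := by
    rw [← Matrix.mul_assoc, hRα', Matrix.sub_mul, Matrix.one_mul, Matrix.smul_mul]
  -- With the denominator cleared, `e5` and `e6` trade each `α` next to the resolvent for `z`; what
  -- remains is the definition of `C` plus `e3` and `e4`.
  have e7 : transfer α (SNext α S Λ) (lamNext α Λ) z * (z • 1 + Complex.I • sig m₁ m₂)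
      = (z • 1 + Complex.I • C) * transfer α S Λ z := by
    simp only [transfer, ← hR, ← hT]
    simp only [Matrix.mul_add, Matrix.add_mul, Matrix.mul_sub, Matrix.sub_mul, Matrix.mul_smul,
      Matrix.smul_mul, Matrix.mul_assoc, Matrix.mul_one, Matrix.one_mul, smul_add, smul_sub,
      smul_smul, Complex.I_mul_I, e5, e6] at e3 e4 ⊢
    have hCj' := congrArg (Complex.I • ·) hCj
    simp only [smul_add, smul_sub, Matrix.mul_assoc] at hCj'
    linear_combination (norm := module) hCj' + e4 + e3
  have s1 : (1 + (Complex.I / z) • sig m₁ m₂) = z⁻¹ • (z • 1 + Complex.I • sig m₁ m₂) := by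
    rw [smul_add, smul_smul, smul_smul, inv_mul_cancel₀ hz0, one_smul, div_eq_inv_mul]
  have s2 : (1 + (Complex.I / z) • C) = z⁻¹ • (z • 1 + Complex.I • C) := by
    rw [smul_add, smul_smul, smul_smul, inv_mul_cancel₀ hz0, one_smul, div_eq_inv_mul]
  rw [s1, s2, Matrix.mul_smul, e7, Matrix.smul_mul]

end Transfer

/-- A Hermitian involution of trace `m₁ - m₂` is unitarily equivalent to `j`. -/
theorem exists_unitary_of_involution {C : Matrix (Fin m₁ ⊕ Fin m₂) (Fin m₁ ⊕ Fin m₂) ℂ}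
    (hC : C.IsHermitian) (h2 : C * C = 1) (htr : C.trace = m₁ - m₂) :
    ∃ U ∈ Matrix.unitaryGroup (Fin m₁ ⊕ Fin m₂) ℂ, C = Uᴴ * sig m₁ m₂ * U := by
  classical
  have hev : ∀ i, hC.eigenvalues i = 1 ∨ hC.eigenvalues i = -1 := by
    intro i
    have e := hC.mulVec_eigenvectorBasis i
    have e2 : (C * C) *ᵥ (hC.eigenvectorBasis i).ofLp
        = (hC.eigenvalues i * hC.eigenvalues i) • (hC.eigenvectorBasis i).ofLp := by
      rw [← Matrix.mulVec_mulVec, e, Matrix.mulVec_smul, e, smul_smul]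
    rw [h2, Matrix.one_mulVec] at e2
    have hne : (hC.eigenvectorBasis i).ofLp ≠ 0 := by
      simpa using hC.eigenvectorBasis.orthonormal.ne_zero i
    have : (hC.eigenvalues i * hC.eigenvalues i - 1) • (hC.eigenvectorBasis i).ofLp = 0 := by
      rw [sub_smul, ← e2, one_smul, sub_self]
    have := (smul_eq_zero.1 this).resolve_right hne
    exact mul_self_eq_one_iff.1 (by linarith)
  set p : Fin m₁ ⊕ Fin m₂ → Prop := fun i => hC.eigenvalues i = 1 with hp
  have hsum : (∑ i, hC.eigenvalues i) = (m₁ : ℝ) - m₂ := by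
    have := hC.trace_eq_sum_eigenvalues
    rw [htr] at this
    have h3 := congrArg Complex.re this
    simpa using h3.symm
  have hcard : Fintype.card {i // p i} + Fintype.card {i // ¬ p i} = m₁ + m₂ := by
    rw [Fintype.card_subtype_compl]
    have := Fintype.card_subtype_le p
    simp at this ⊢
    omega
  -- All eigenvalues are `±1`, so their number and their sum determine the two multiplicities.
  have hdiff : (Fintype.card {i // p i} : ℝ) - Fintype.card {i // ¬ p i} = m₁ - m₂ := by
    rw [← hsum, ← Fintype.sum_subtype_add_sum_subtype p]
    rw [Finset.sum_congr rfl (g := fun _ => (1 : ℝ)) fun i _ => i.2,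
      Finset.sum_congr rfl (s₁ := (Finset.univ : Finset {i // ¬ p i})) (g := fun _ => (-1 : ℝ))
        fun i _ => (hev i).resolve_left i.2]
    simp [sub_eq_add_neg]
  have hc1 : Fintype.card {i // p i} = m₁ := by
    have h1 : (Fintype.card {i // p i} : ℝ) + Fintype.card {i // ¬ p i} = m₁ + m₂ := by
      exact_mod_cast hcard
    have : (Fintype.card {i // p i} : ℝ) = m₁ := by linarith
    exact_mod_cast this
  have hc2 : Fintype.card {i // ¬ p i} = m₂ := by omega
  -- This permutation lists the eigenvalues `1` first, so the reordered diagonal matrix is exactly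
  -- `j`.
  let e : Fin m₁ ⊕ Fin m₂ ≃ Fin m₁ ⊕ Fin m₂ :=
    ((Fintype.equivFinOfCardEq hc1).symm.sumCongr (Fintype.equivFinOfCardEq hc2).symm).trans
      (Equiv.sumCompl p)
  have he : sig m₁ m₂
      = (Matrix.diagonal ((fun x : ℝ => (x : ℂ)) ∘ hC.eigenvalues)).submatrix e e := by
    rw [Matrix.submatrix_diagonal_equiv, sig, ← Matrix.diagonal_one, ← Matrix.diagonal_one,
      Matrix.diagonal_neg, Matrix.fromBlocks_diagonal]
    congr 1
    ext i
    rcases i with i | i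
    · have := ((Fintype.equivFinOfCardEq hc1).symm i).2
      simp only [hp] at this
      simp [e, this]
    · have h := (hev _).resolve_left ((Fintype.equivFinOfCardEq hc2).symm i).2
      simp [e, h]
  set V : Matrix (Fin m₁ ⊕ Fin m₂) (Fin m₁ ⊕ Fin m₂) ℂ :=
    hC.eigenvectorUnitary.1 with hV
  have hVu : Vᴴ * V = 1 := Matrix.mem_unitaryGroup_iff'.1 hC.eigenvectorUnitary.2
  refine ⟨(V.submatrix id e)ᴴ, ?_, ?_⟩
  · rw [Matrix.mem_unitaryGroup_iff, Matrix.star_eq_conjTranspose,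
      Matrix.conjTranspose_conjTranspose, Matrix.conjTranspose_submatrix,
      ← Matrix.submatrix_mul _ _ _ _ _ Function.bijective_id, hVu, Matrix.submatrix_one_equiv]
  · rw [Matrix.conjTranspose_conjTranspose, he, Matrix.conjTranspose_submatrix,
      Matrix.submatrix_mul_equiv, Matrix.submatrix_mul_equiv, Matrix.submatrix_id_id]
    conv_lhs => rw [hC.spectral_theorem]
    rw [Unitary.conjStarAlgAut_apply]
    rfl

/-! ### Dirac form of the potential and the fundamental solution. -/

section

variable {α S : Matrix (Fin n) (Fin n) ℂ} {Λ : Matrix (Fin n) (Fin m₁ ⊕ Fin m₂) ℂ}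

/-- Cyclicity of the trace reduces everything to `α`, so the value does not change along the
recursion. This fixes the trace of `C_k` and later makes the lower bound on `w_k` uniform in `k`. -/
theorem trace_conjTranspose_mul_inv_mul (hS : S.PosDef)
    (hl : α * S - S * αᴴ = Complex.I • (Λ * Λᴴ)) :
    (Λᴴ * S⁻¹ * Λ).trace = ((2 * α.trace.im : ℝ) : ℂ) := by
  have hSd := (Matrix.isUnit_iff_isUnit_det _).1 hS.isUnit
  have h1 : Λ * Λᴴ = (-Complex.I) • (α * S - S * αᴴ) := by
    rw [hl, smul_smul]; simp
  have h2 : (S⁻¹ * (α * S)).trace = α.trace := by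
    rw [Matrix.trace_mul_comm, Matrix.mul_assoc, Matrix.mul_nonsing_inv _ hSd, Matrix.mul_one]
  have h3 : (S⁻¹ * (S * αᴴ)).trace = star α.trace := by
    rw [Matrix.nonsing_inv_mul_cancel_left _ _ hSd, Matrix.trace_conjTranspose]
  rw [Matrix.mul_assoc, Matrix.trace_mul_comm, Matrix.mul_assoc, h1, Matrix.mul_smul,
    Matrix.trace_smul, Matrix.mul_sub, Matrix.trace_sub, h2, h3]
  apply Complex.ext <;> simp
  ring

/-- At `z = 1` the transfer matrices are unitary, so the Darboux relation reads `I + i C = w' (I + i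
j) w*` and `(I + i C)(I + i C)* = 2 I`. As `C` is Hermitian, `C² = I`; its trace equals that of `j`.
-/
theorem IsStronglyAdmissible.isDiracPotential
    (h : IsStronglyAdmissible α S Λ.toCols₁ Λ.toCols₂) (hi : Complex.I ∉ spectrum ℂ α) :
    IsDiracPotential (potential α Λ S) := by
  intro k
  have hk := h.seq hi k
  have hk' := h.seq hi (k + 1)
  obtain ⟨hS, hl, -⟩ := isStronglyAdmissible_toCols_iff.1 hk
  obtain ⟨hS', hl', -⟩ := isStronglyAdmissible_toCols_iff.1 hk'
  have hz : IsUnit ((1 : ℂ) • 1 + α) := h.isUnit_smul_one_add (by simp)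
  have hD : transfer α (SSeq α Λ S (k + 1)) (lamSeq α Λ (k + 1)) 1
      * (1 + (Complex.I / 1) • sig m₁ m₂)
      = (1 + (Complex.I / 1) • potential α Λ S k) *
        transfer α (SSeq α Λ S k) (lamSeq α Λ k) 1 :=
    transfer_darboux h.isUnit hS hS' hl one_ne_zero hz
  have hw := transfer_conjTranspose_mul_self hS hl hz
  have hw' := transfer_conjTranspose_mul_self hS' hl' hz
  have hCh : (potential α Λ S k).IsHermitian := by
    have i1 : ((SSeq α Λ S k)⁻¹)ᴴ = (SSeq α Λ S k)⁻¹ := hS.inv.isHermitian.eq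
    have i2 : ((SSeq α Λ S (k + 1))⁻¹)ᴴ = (SSeq α Λ S (k + 1))⁻¹ := hS'.inv.isHermitian.eq
    simp only [potential, Matrix.IsHermitian, Matrix.conjTranspose_sub, Matrix.conjTranspose_add,
      Matrix.conjTranspose_mul, Matrix.conjTranspose_conjTranspose, sig_conjTranspose, i1, i2,
      Matrix.mul_assoc]
  refine exists_unitary_of_involution hCh ?_ ?_
  · generalize transfer α (SSeq α Λ S (k + 1)) (lamSeq α Λ (k + 1)) 1 = w' at *
    generalize transfer α (SSeq α Λ S k) (lamSeq α Λ k) 1 = w at *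
    generalize potential α Λ S k = C at *
    simp only [Complex.one_im, Complex.ofReal_zero, mul_zero, zero_smul, sub_zero, div_one] at *
    have hwr : w * wᴴ = 1 := mul_eq_one_comm.1 hw
    have hwr' : w' * w'ᴴ = 1 := mul_eq_one_comm.1 hw'
    have e1 : (1 + Complex.I • C) * (1 + Complex.I • C)ᴴ = (2 : ℂ) • 1 := by
      have a1 : 1 + Complex.I • C = w' * (1 + Complex.I • sig m₁ m₂) * wᴴ := by
        rw [hD, Matrix.mul_assoc, hwr, Matrix.mul_one]
      have a2 : (1 + Complex.I • sig m₁ m₂) * (1 + Complex.I • sig m₁ m₂)ᴴ = (2 : ℂ) • 1 := by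
        simp only [Matrix.conjTranspose_add, Matrix.conjTranspose_one, Matrix.conjTranspose_smul,
          sig_conjTranspose, Complex.star_def, Complex.conj_I, Matrix.mul_add, Matrix.add_mul,
          Matrix.mul_one, Matrix.one_mul, Matrix.smul_mul, Matrix.mul_smul, sig_mul_sig, smul_add,
          smul_smul, neg_mul, Complex.I_mul_I]
        module
      rw [a1, Matrix.conjTranspose_mul, Matrix.conjTranspose_mul,
        Matrix.conjTranspose_conjTranspose,
        show w' * (1 + Complex.I • sig m₁ m₂) * wᴴ * (w * ((1 + Complex.I • sig m₁ m₂)ᴴ * w'ᴴ))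
          = w' * ((1 + Complex.I • sig m₁ m₂) * ((wᴴ * w) * (1 + Complex.I • sig m₁ m₂)ᴴ)) * w'ᴴ by
          simp only [Matrix.mul_assoc], hw, Matrix.one_mul, a2, Matrix.mul_smul, Matrix.mul_one,
        Matrix.smul_mul, hwr']
    simp only [Matrix.conjTranspose_add, Matrix.conjTranspose_one, Matrix.conjTranspose_smul,
      hCh.eq, Complex.star_def, Complex.conj_I, Matrix.mul_add, Matrix.add_mul,
      Matrix.mul_one, Matrix.one_mul, Matrix.smul_mul, Matrix.mul_smul, smul_add,
      smul_smul, neg_mul, Complex.I_mul_I] at e1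
    linear_combination (norm := module) e1
  · rw [potential, Matrix.trace_sub, Matrix.trace_add, trace_conjTranspose_mul_inv_mul hS hl,
      trace_conjTranspose_mul_inv_mul hS' hl', add_sub_cancel_right, sig]
    simp [Matrix.trace, Fintype.sum_sum_type, sub_eq_add_neg]

theorem one_add_smul_sig_pow (c : ℂ) (k : ℕ) :
    (1 + c • sig m₁ m₂) ^ k
      = Matrix.fromBlocks ((1 + c) ^ k • 1) 0 0 ((1 - c) ^ k • 1) := by
  have h1 : 1 + c • sig m₁ m₂ = Matrix.fromBlocks ((1 + c) • 1) 0 0 ((1 - c) • 1) := by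
    rw [sig, Matrix.fromBlocks_smul, ← Matrix.fromBlocks_one, Matrix.fromBlocks_add]
    simp [add_smul, sub_eq_add_neg]
  induction k with
  | zero => simp
  | succ k ih =>
    rw [pow_succ, ih, h1, Matrix.fromBlocks_multiply]
    simp [smul_smul, pow_succ, mul_comm]

/-- The iterated Darboux relation: growth in `k` is carried by a diagonal power alone. -/
theorem IsStronglyAdmissible.fundSol_mul_transfer
    (h : IsStronglyAdmissible α S Λ.toCols₁ Λ.toCols₂) (hi : Complex.I ∉ spectrum ℂ α)
    {z : ℂ} (hz : 0 < z.im) (k : ℕ) :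
    fundSol (potential α Λ S) z k * transfer α S Λ z
      = transfer α (SSeq α Λ S k) (lamSeq α Λ k) z * (1 + (Complex.I / z) • sig m₁ m₂) ^ k := by
  have hz0 : z ≠ 0 := by rintro rfl; simp at hz
  have hzu : IsUnit (z • 1 + α) := h.isUnit_smul_one_add hz.le
  induction k with
  | zero => simp [fundSol, SSeq, lamSeq]
  | succ k ih =>
    obtain ⟨hS, hl, -⟩ := isStronglyAdmissible_toCols_iff.1 (h.seq hi k)
    obtain ⟨hS', -, -⟩ := isStronglyAdmissible_toCols_iff.1 (h.seq hi (k + 1))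
    have hD : transfer α (SSeq α Λ S (k + 1)) (lamSeq α Λ (k + 1)) z
        * (1 + (Complex.I / z) • sig m₁ m₂)
        = (1 + (Complex.I / z) • potential α Λ S k) *
          transfer α (SSeq α Λ S k) (lamSeq α Λ k) z :=
      transfer_darboux h.isUnit hS hS' hl hz0 hzu
    rw [fundSol, Matrix.mul_assoc, ih, ← Matrix.mul_assoc, ← hD, Matrix.mul_assoc, ← pow_succ']

end

/-- The state-space formula for the Weyl function. -/
noncomputable def weylState (α S : Matrix (Fin n) (Fin n) ℂ)
    (Λ : Matrix (Fin n) (Fin m₁ ⊕ Fin m₂) ℂ) (z : ℂ) : Matrix (Fin m₁) (Fin m₂) ℂ :=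
  (-Complex.I) • (Λ.toCols₁ᴴ * S⁻¹
    * (z • 1 + (α - Complex.I • (Λ.toCols₂ * Λ.toCols₂ᴴ * S⁻¹)))⁻¹ * Λ.toCols₂)

/-! ### The state-space formula as the image of decaying trivial solutions. -/

section

variable {α S : Matrix (Fin n) (Fin n) ℂ} {Λ : Matrix (Fin n) (Fin m₁ ⊕ Fin m₂) ℂ}

theorem transfer_mul_fromRows_zero (z : ℂ) (X : Matrix (Fin m₂) (Fin m₂) ℂ) :
    transfer α S Λ z * Matrix.fromRows (0 : Matrix (Fin m₁) (Fin m₂) ℂ) X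
      = Matrix.fromRows (-(Complex.I • (Λ.toCols₁ᴴ * S⁻¹ * (z • 1 + α)⁻¹ * Λ.toCols₂ * X)))
        (X - Complex.I • (Λ.toCols₂ᴴ * S⁻¹ * (z • 1 + α)⁻¹ * Λ.toCols₂ * X)) := by
  have h1 : Λ * Matrix.fromRows (0 : Matrix (Fin m₁) (Fin m₂) ℂ) X = Λ.toCols₂ * X := by
    conv_lhs => rw [← Matrix.fromCols_toCols Λ, Matrix.fromCols_mul_fromRows]
    simp
  have h2 : Λᴴ = Matrix.fromRows Λ.toCols₁ᴴ Λ.toCols₂ᴴ := by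
    conv_lhs => rw [← Matrix.fromCols_toCols Λ,
      Matrix.conjTranspose_fromCols_eq_fromRows_conjTranspose]
  rw [transfer, Matrix.sub_mul, Matrix.one_mul, Matrix.smul_mul, Matrix.mul_assoc _ Λ, h1, h2]
  simp only [Matrix.fromRows_mul, Matrix.mul_assoc]
  ext i j
  rcases i with i | i <;> simp

theorem exists_transfer_mul_eq_weylState {z : ℂ} (hz : IsUnit (z • 1 + α))
    (hβ : IsUnit (z • 1 + (α - Complex.I • (Λ.toCols₂ * Λ.toCols₂ᴴ * S⁻¹)))) :
    ∃ X : Matrix (Fin m₂) (Fin m₂) ℂ,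
      transfer α S Λ z * Matrix.fromRows (0 : Matrix (Fin m₁) (Fin m₂) ℂ) X
        = Matrix.fromRows (weylState α S Λ z) 1 := by
  have hzd := (Matrix.isUnit_iff_isUnit_det _).1 hz
  have hβd := (Matrix.isUnit_iff_isUnit_det _).1 hβ
  set θ₁ := Λ.toCols₁ with hθ₁
  set θ₂ := Λ.toCols₂ with hθ₂
  set B := z • 1 + (α - Complex.I • (θ₂ * θ₂ᴴ * S⁻¹)) with hB
  set A := z • 1 + α with hA
  have hAB : A - B = Complex.I • (θ₂ * θ₂ᴴ * S⁻¹) := by rw [hA, hB]; abel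
  -- resolvent identity
  have key : A⁻¹ + Complex.I • (A⁻¹ * (θ₂ * (θ₂ᴴ * (S⁻¹ * B⁻¹)))) = B⁻¹ := by
    have : A⁻¹ * (A - B) * B⁻¹ = B⁻¹ - A⁻¹ := by
      rw [Matrix.mul_sub, Matrix.sub_mul, Matrix.nonsing_inv_mul _ hzd, Matrix.one_mul,
        Matrix.mul_assoc, Matrix.mul_nonsing_inv _ hβd, Matrix.mul_one]
    rw [hAB] at this
    simp only [Matrix.mul_smul, Matrix.smul_mul, Matrix.mul_assoc] at this
    rw [this]; abel
  -- The inverse of the lower right block `1 - i θ₂* S⁻¹ A⁻¹ θ₂` of the transfer matrix; it converts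
  -- `A⁻¹ θ₂` into `B⁻¹ θ₂`.
  refine ⟨1 + Complex.I • (θ₂ᴴ * S⁻¹ * B⁻¹ * θ₂), ?_⟩
  have k2 : A⁻¹ * θ₂ * (1 + Complex.I • (θ₂ᴴ * S⁻¹ * B⁻¹ * θ₂)) = B⁻¹ * θ₂ := by
    conv_rhs => rw [← key]
    simp only [Matrix.mul_add, Matrix.add_mul, Matrix.mul_one, Matrix.mul_smul, Matrix.smul_mul,
      Matrix.mul_assoc]
  rw [transfer_mul_fromRows_zero, ← hθ₁, ← hθ₂, ← hA]
  have k3 : ∀ T : Matrix (Fin n) (Fin n) ℂ, ∀ (p : ℕ) (Q : Matrix (Fin p) (Fin n) ℂ),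
      Q * T * A⁻¹ * θ₂ * (1 + Complex.I • (θ₂ᴴ * S⁻¹ * B⁻¹ * θ₂)) = Q * T * B⁻¹ * θ₂ := by
    intro T p Q
    rw [Matrix.mul_assoc (Q * T), Matrix.mul_assoc (Q * T), k2, ← Matrix.mul_assoc]
  rw [k3, k3, weylState, ← hθ₁, ← hθ₂, ← hB]
  congr 1
  · rw [neg_smul]
  · abel

theorem transfer_mul_fromRows_zero_unique {z : ℂ} {X X' : Matrix (Fin m₂) (Fin m₂) ℂ}
    {φ φ' : Matrix (Fin m₁) (Fin m₂) ℂ}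
    (h : transfer α S Λ z * Matrix.fromRows (0 : Matrix (Fin m₁) (Fin m₂) ℂ) X
      = Matrix.fromRows φ 1)
    (h' : transfer α S Λ z * Matrix.fromRows (0 : Matrix (Fin m₁) (Fin m₂) ℂ) X'
      = Matrix.fromRows φ' 1) : φ = φ' := by
  rw [transfer_mul_fromRows_zero, Matrix.fromRows_ext_iff] at h h'
  have inv : ∀ Y : Matrix (Fin m₂) (Fin m₂) ℂ,
      Y - Complex.I • (Λ.toCols₂ᴴ * S⁻¹ * (z • 1 + α)⁻¹ * Λ.toCols₂ * Y)
        = (1 - Complex.I • (Λ.toCols₂ᴴ * S⁻¹ * (z • 1 + α)⁻¹ * Λ.toCols₂)) * Y := fun Y => by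
    rw [Matrix.sub_mul, Matrix.one_mul, Matrix.smul_mul]
  obtain ⟨h1, h2⟩ := h
  obtain ⟨h1', h2'⟩ := h'
  rw [inv] at h2 h2'
  have hX : X = X' := left_inv_eq_right_inv (mul_eq_one_comm.1 h2) h2'
  rw [← h1, ← h1', hX]

end

/-! ### Column norms and Cauchy–Schwarz estimates. -/

section ColumnNorms

variable {ι κ κ' : Type*} [Fintype ι] [Fintype κ]

/-- The squared Euclidean norm of a column of a matrix. -/
noncomputable def colSq (Y : Matrix ι κ' ℂ) (a : κ') : ℝ := ∑ c, ‖Y c a‖ ^ 2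

theorem colSq_nonneg (Y : Matrix ι κ' ℂ) (a : κ') : 0 ≤ colSq Y a :=
  Finset.sum_nonneg fun _ _ => sq_nonneg _

theorem sq_norm_le_colSq (Y : Matrix ι κ' ℂ) (c : ι) (a : κ') : ‖Y c a‖ ^ 2 ≤ colSq Y a :=
  Finset.single_le_sum (f := fun c => ‖Y c a‖ ^ 2) (fun _ _ => sq_nonneg _) (Finset.mem_univ c)

theorem conjTranspose_mul_self_apply_self (Y : Matrix ι κ' ℂ) (a : κ') :
    (Yᴴ * Y : Matrix κ' κ' ℂ) a a = colSq Y a := by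
  simp [colSq, Matrix.mul_apply, Complex.conj_mul']

theorem norm_conjTranspose_mul_self_apply_le (Y : Matrix ι κ' ℂ) (a b : κ') :
    ‖(Yᴴ * Y : Matrix κ' κ' ℂ) a b‖ ≤ colSq Y a + colSq Y b := by
  rw [Matrix.mul_apply, colSq, colSq, ← Finset.sum_add_distrib]
  refine (norm_sum_le _ _).trans (Finset.sum_le_sum fun c _ => ?_)
  rw [norm_mul, Matrix.conjTranspose_apply, norm_star]
  nlinarith [sq_nonneg (‖Y c a‖ - ‖Y c b‖), sq_nonneg ‖Y c a‖, sq_nonneg ‖Y c b‖]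

theorem colSq_conjTranspose_mul_le (A : Matrix ι κ ℂ) (Y : Matrix ι κ' ℂ) (a : κ') :
    colSq (Aᴴ * Y) a ≤ (∑ c, colSq A c) * colSq Y a := by
  rw [colSq, Finset.sum_mul]
  refine Finset.sum_le_sum fun c _ => ?_
  have h1 : ‖(Aᴴ * Y : Matrix κ κ' ℂ) c a‖ ≤ ∑ i, ‖A i c‖ * ‖Y i a‖ := by
    rw [Matrix.mul_apply]
    refine (norm_sum_le _ _).trans (Finset.sum_le_sum fun i _ => ?_)
    rw [norm_mul, Matrix.conjTranspose_apply, norm_star]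
  calc ‖(Aᴴ * Y : Matrix κ κ' ℂ) c a‖ ^ 2 ≤ (∑ i, ‖A i c‖ * ‖Y i a‖) ^ 2 := by gcongr
    _ ≤ colSq A c * colSq Y a := Finset.sum_mul_sq_le_sq_mul_sq _ _ _

theorem colSq_add_le (Y Z : Matrix ι κ' ℂ) (a : κ') :
    colSq (Y + Z) a ≤ 2 * colSq Y a + 2 * colSq Z a := by
  simp only [colSq, Finset.mul_sum, ← Finset.sum_add_distrib]
  refine Finset.sum_le_sum fun c _ => ?_
  have := norm_add_le (Y c a) (Z c a)
  rw [Matrix.add_apply]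
  nlinarith [sq_nonneg (‖Y c a‖ - ‖Z c a‖), norm_nonneg (Y c a + Z c a)]

theorem colSq_smul (r : ℂ) (Y : Matrix ι κ' ℂ) (a : κ') :
    colSq (r • Y) a = ‖r‖ ^ 2 * colSq Y a := by
  simp [colSq, Finset.mul_sum, mul_pow]

end ColumnNorms

/-- Cauchy–Schwarz after factoring `S⁻¹ = E* E`, with the Hilbert–Schmidt norm of `E Λ` in place of
the operator norm, so that only a trace enters. -/
theorem colSq_mul_inv_mul_le {ι κ : Type*} [Fintype ι] [Fintype κ] {S : Matrix (Fin n) (Fin n) ℂ}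
    (hS : S.PosDef) (Λ : Matrix (Fin n) ι ℂ) (X : Matrix (Fin n) κ ℂ) (a : κ) :
    colSq (Λᴴ * S⁻¹ * X) a ≤ (Λᴴ * S⁻¹ * Λ).trace.re * ((Xᴴ * S⁻¹ * X : Matrix κ κ ℂ) a a).re := by
  obtain ⟨E, hSE⟩ : ∃ E : Matrix (Fin n) (Fin n) ℂ, S⁻¹ = Eᴴ * E := by
    open scoped MatrixOrder in
    obtain ⟨y, -, h⟩ := CStarAlgebra.isStrictlyPositive_iff_eq_star_mul_self.mp
      hS.inv.isStrictlyPositive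
    exact ⟨y, h⟩
  have e1 : Λᴴ * S⁻¹ * X = (E * Λ)ᴴ * (E * X) := by
    rw [hSE, Matrix.conjTranspose_mul]; simp only [Matrix.mul_assoc]
  have e2 : Λᴴ * S⁻¹ * Λ = (E * Λ)ᴴ * (E * Λ) := by
    rw [hSE, Matrix.conjTranspose_mul]; simp only [Matrix.mul_assoc]
  have e3 : Xᴴ * S⁻¹ * X = (E * X)ᴴ * (E * X) := by
    rw [hSE, Matrix.conjTranspose_mul]; simp only [Matrix.mul_assoc]
  rw [e1, e2, e3, conjTranspose_mul_self_apply_self, Complex.ofReal_re, Matrix.trace]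
  simp only [Matrix.diag_apply, conjTranspose_mul_self_apply_self]
  rw [← Complex.ofReal_sum, Complex.ofReal_re]
  exact colSq_conjTranspose_mul_le _ _ _

/-! ### Bounds on the transfer function and square summable solutions. -/

section

variable {α S : Matrix (Fin n) (Fin n) ℂ} {Λ : Matrix (Fin n) (Fin m₁ ⊕ Fin m₂) ℂ}

theorem colSq_transfer_mul (hS : S.PosDef)
    (hl : α * S - S * αᴴ = Complex.I • (Λ * Λᴴ)) {z : ℂ} (hz : IsUnit (z • 1 + α))
    {κ : Type*} [Fintype κ] (Z : Matrix (Fin m₁ ⊕ Fin m₂) κ ℂ) (a : κ) :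
    colSq (transfer α S Λ z * Z) a = colSq Z a - 2 * z.im *
      ((((z • 1 + α)⁻¹ * Λ * Z)ᴴ * S⁻¹ * ((z • 1 + α)⁻¹ * Λ * Z) : Matrix κ κ ℂ) a a).re := by
  have h := transfer_conjTranspose_mul_self hS hl hz
  have h1 : (transfer α S Λ z * Z)ᴴ * (transfer α S Λ z * Z) = Zᴴ * Z - (2 * z.im : ℂ) •
      (((z • 1 + α)⁻¹ * Λ * Z)ᴴ * S⁻¹ * ((z • 1 + α)⁻¹ * Λ * Z)) := by
    rw [Matrix.conjTranspose_mul, Matrix.mul_assoc, ← Matrix.mul_assoc _ (transfer α S Λ z), h]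
    simp only [Matrix.sub_mul, Matrix.mul_sub, Matrix.one_mul, Matrix.smul_mul, Matrix.mul_smul,
      Matrix.conjTranspose_mul, Matrix.mul_assoc]
  have h2 := congrArg (fun Y => (Y a a).re) h1
  simp only [conjTranspose_mul_self_apply_self, Matrix.sub_apply, Matrix.smul_apply,
    Complex.sub_re, Complex.ofReal_re] at h2
  rw [h2, smul_eq_mul, show (2 * z.im : ℂ) = ((2 * z.im : ℝ) : ℂ) by push_cast; rfl,
    Complex.re_ofReal_mul]

theorem colSq_transfer_mul_le (hS : S.PosDef)
    (hl : α * S - S * αᴴ = Complex.I • (Λ * Λᴴ)) {z : ℂ} (hz : IsUnit (z • 1 + α))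
    (hzi : 0 ≤ z.im) {κ : Type*} [Fintype κ] (Z : Matrix (Fin m₁ ⊕ Fin m₂) κ ℂ) (a : κ) :
    colSq (transfer α S Λ z * Z) a ≤ colSq Z a := by
  rw [colSq_transfer_mul hS hl hz]
  have hN := (Complex.le_def.1 ((hS.inv.posSemidef.conjTranspose_mul_mul_same
    ((z • 1 + α)⁻¹ * Λ * Z)).diag_nonneg (i := a))).1
  rw [Complex.zero_re] at hN
  have := mul_nonneg hzi hN
  linarith

/-- The threshold depends on `α` alone, so one `z` serves every step of the recursion. -/
theorem le_colSq_transfer_mul (hS : S.PosDef)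
    (hl : α * S - S * αᴴ = Complex.I • (Λ * Λᴴ)) {z : ℂ} (hz : IsUnit (z • 1 + α))
    (hzt : 4 * α.trace.im ≤ z.im) {κ : Type*} [Fintype κ]
    (Z : Matrix (Fin m₁ ⊕ Fin m₂) κ ℂ) (a : κ) :
    colSq Z a ≤ 4 * colSq (transfer α S Λ z * Z) a := by
  have e1 := colSq_transfer_mul hS hl hz Z a
  have e2 := colSq_mul_inv_mul_le hS Λ ((z • 1 + α)⁻¹ * Λ * Z) a
  rw [trace_conjTranspose_mul_inv_mul hS hl, Complex.ofReal_re] at e2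
  have e3 : Z = transfer α S Λ z * Z + Complex.I • (Λᴴ * S⁻¹ * ((z • 1 + α)⁻¹ * Λ * Z)) := by
    rw [transfer, Matrix.sub_mul, Matrix.one_mul, Matrix.smul_mul]
    simp only [Matrix.mul_assoc]
    abel
  have e4 := colSq_add_le (transfer α S Λ z * Z)
    (Complex.I • (Λᴴ * S⁻¹ * ((z • 1 + α)⁻¹ * Λ * Z))) a
  rw [← e3, colSq_smul, Complex.norm_I, one_pow, one_mul] at e4
  have hN := (Complex.le_def.1 ((hS.inv.posSemidef.conjTranspose_mul_mul_same
    ((z • 1 + α)⁻¹ * Λ * Z)).diag_nonneg (i := a))).1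
  rw [Complex.zero_re] at hN
  have hw := colSq_nonneg (transfer α S Λ z * Z) a
  generalize ((((z • 1 + α)⁻¹ * Λ * Z)ᴴ * S⁻¹ * ((z • 1 + α)⁻¹ * Λ * Z) :
    Matrix κ κ ℂ) a a).re = N at *
  -- By `e2` and `e4`, `|Z|² ≤ 2 |wZ|² + 4 (Im tr α) N ≤ 2 |wZ|² + (Im z) N`, while `e1` gives `2
  -- (Im z) N = |Z|² - |wZ|²`. So even the factor `3` would do.
  nlinarith [mul_nonneg (sub_nonneg.2 hzt) hN]

/-- The origin of the bound `1/2`: `z` is closer to `i` than to `0` exactly when `Im z > 1/2`. -/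
theorem norm_one_sub_I_div_lt_one {z : ℂ} (hz : 1 / 2 < z.im) : ‖1 - Complex.I / z‖ < 1 := by
  have hz0 : z ≠ 0 := by rintro rfl; norm_num at hz
  rw [show 1 - Complex.I / z = (z - Complex.I) / z by field_simp, norm_div,
    div_lt_one (norm_pos_iff.2 hz0), ← sq_lt_sq₀ (norm_nonneg _) (norm_nonneg _),
    ← Complex.normSq_eq_norm_sq, ← Complex.normSq_eq_norm_sq, Complex.normSq_apply,
    Complex.normSq_apply]
  simp
  nlinarith

theorem one_le_norm_one_add_I_div {z : ℂ} (hz : 0 < z.im) : 1 ≤ ‖1 + Complex.I / z‖ := by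
  have hz0 : z ≠ 0 := by rintro rfl; norm_num at hz
  rw [show 1 + Complex.I / z = (z + Complex.I) / z by field_simp, norm_div,
    one_le_div (norm_pos_iff.2 hz0), ← sq_le_sq₀ (norm_nonneg _) (norm_nonneg _),
    ← Complex.normSq_eq_norm_sq, ← Complex.normSq_eq_norm_sq, Complex.normSq_apply,
    Complex.normSq_apply]
  simp
  nlinarith

/-- The summands are Gram matrices: diagonal entries are squared column norms, and these dominate
the other entries. -/
theorem weylSummable_iff {C : ℕ → Matrix (Fin m₁ ⊕ Fin m₂) (Fin m₁ ⊕ Fin m₂) ℂ} {z : ℂ}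
    {X : Matrix (Fin m₁) (Fin m₂) ℂ} :
    WeylSummable C z X ↔ ∀ a, Summable fun k =>
      colSq (fundSol C z k * Matrix.fromRows X (1 : Matrix (Fin m₂) (Fin m₂) ℂ)) a := by
  have e : ∀ k, Matrix.fromCols Xᴴ (1 : Matrix (Fin m₂) (Fin m₂) ℂ) * (fundSol C z k)ᴴ
      * fundSol C z k * Matrix.fromRows X (1 : Matrix (Fin m₂) (Fin m₂) ℂ)
      = (fundSol C z k * Matrix.fromRows X (1 : Matrix (Fin m₂) (Fin m₂) ℂ))ᴴ
        * (fundSol C z k * Matrix.fromRows X (1 : Matrix (Fin m₂) (Fin m₂) ℂ)) := by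
    intro k
    rw [Matrix.conjTranspose_mul, Matrix.conjTranspose_fromRows_eq_fromCols_conjTranspose,
      Matrix.conjTranspose_one]
    simp only [Matrix.mul_assoc]
  rw [WeylSummable]
  simp_rw [e]
  constructor
  · intro h a
    have := Pi.summable.1 (Pi.summable.1 h a) a
    simp only [conjTranspose_mul_self_apply_self] at this
    exact_mod_cast this
  · intro h
    refine Pi.summable.2 fun a => Pi.summable.2 fun b => ?_
    exact Summable.of_norm_bounded ((h a).add (h b))
      fun k => norm_conjTranspose_mul_self_apply_le _ a b

/-- The state-space formula provides square summable solutions. -/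
theorem IsStronglyAdmissible.weylSummable
    (h : IsStronglyAdmissible α S Λ.toCols₁ Λ.toCols₂) (hi : Complex.I ∉ spectrum ℂ α)
    {z : ℂ} (hz : 1 / 2 < z.im)
    (hβ : IsUnit (z • 1 + (α - Complex.I • (Λ.toCols₂ * Λ.toCols₂ᴴ * S⁻¹)))) :
    WeylSummable (potential α Λ S) z (weylState α S Λ z) := by
  have hz' : 0 < z.im := by linarith
  have hzu := h.isUnit_smul_one_add hz'.le
  obtain ⟨X, hX⟩ := exists_transfer_mul_eq_weylState hzu hβ
  rw [weylSummable_iff]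
  intro a
  -- The trivial solution starting at `[0; X]` is multiplied by `1 - i/z` at each step, and `w_k`
  -- does not increase column norms.
  have key : ∀ k, colSq (fundSol (potential α Λ S) z k
      * Matrix.fromRows (weylState α S Λ z) (1 : Matrix (Fin m₂) (Fin m₂) ℂ)) a
      ≤ (‖1 - Complex.I / z‖ ^ 2) ^ k
        * colSq (Matrix.fromRows (0 : Matrix (Fin m₁) (Fin m₂) ℂ) X) a := by
    intro k
    obtain ⟨hSk, hlk, -⟩ := isStronglyAdmissible_toCols_iff.1 (h.seq hi k)
    rw [← hX, ← Matrix.mul_assoc, h.fundSol_mul_transfer hi hz', Matrix.mul_assoc]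
    refine (colSq_transfer_mul_le hSk hlk hzu hz'.le _ a).trans_eq ?_
    have : (1 + (Complex.I / z) • sig m₁ m₂) ^ k
        * Matrix.fromRows (0 : Matrix (Fin m₁) (Fin m₂) ℂ) X
        = (1 - Complex.I / z) ^ k • Matrix.fromRows (0 : Matrix (Fin m₁) (Fin m₂) ℂ) X := by
      rw [one_add_smul_sig_pow, Matrix.fromBlocks_mul_fromRows]
      ext i j
      rcases i with i | i <;> simp
    rw [this, colSq_smul, norm_pow]
    ring
  refine Summable.of_nonneg_of_le (fun k => colSq_nonneg _ _) key ?_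
  refine (summable_geometric_of_lt_one (sq_nonneg _) ?_).mul_right _
  exact pow_lt_one₀ (norm_nonneg _) (norm_one_sub_I_div_lt_one hz) two_ne_zero

/-- Far from the real axis, only the state-space formula provides square summable solutions. -/
theorem IsStronglyAdmissible.eq_weylState
    (h : IsStronglyAdmissible α S Λ.toCols₁ Λ.toCols₂) (hi : Complex.I ∉ spectrum ℂ α)
    {z : ℂ} (hz : 0 < z.im) (hzt : 4 * α.trace.im ≤ z.im)
    (hβ : IsUnit (z • 1 + (α - Complex.I • (Λ.toCols₂ * Λ.toCols₂ᴴ * S⁻¹))))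
    {φ : Matrix (Fin m₁) (Fin m₂) ℂ} (hφ : WeylSummable (potential α Λ S) z φ) :
    φ = weylState α S Λ z := by
  have hzu := h.isUnit_smul_one_add hz.le
  obtain ⟨hS, hl, -⟩ := isStronglyAdmissible_toCols_iff.1 h
  obtain ⟨X, hX⟩ := exists_transfer_mul_eq_weylState hzu hβ
  have hunit : IsUnit (transfer α S Λ z) := by
    rw [Matrix.isUnit_iff_isUnit_det, isUnit_iff_ne_zero]
    intro h0
    obtain ⟨v, hv, hv0⟩ := Matrix.exists_mulVec_eq_zero_iff.2 h0
    apply hv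
    have e := le_colSq_transfer_mul hS hl hzu hzt (Matrix.replicateCol Unit v) ()
    rw [← Matrix.replicateCol_mulVec, hv0] at e
    ext i
    have := (sq_norm_le_colSq (Matrix.replicateCol Unit v) i ()).trans e
    simpa [colSq] using this
  have hud := (Matrix.isUnit_iff_isUnit_det _).1 hunit
  set c := (transfer α S Λ z)⁻¹ * Matrix.fromRows φ (1 : Matrix (Fin m₂) (Fin m₂) ℂ) with hc
  have hwc : transfer α S Λ z * c = Matrix.fromRows φ (1 : Matrix (Fin m₂) (Fin m₂) ℂ) := by
    rw [hc, Matrix.mul_nonsing_inv_cancel_left _ _ hud]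
  -- The upper entries are multiplied by `(1 + i/z)^k`, of modulus at least one, so the lower bound
  -- on `w_k` keeps the terms of the series away from zero unless these entries vanish.
  have hc1 : ∀ i a, c (Sum.inl i) a = 0 := by
    intro i a
    have hsum := weylSummable_iff.1 hφ a
    have hb : ∀ k, ‖c (Sum.inl i) a‖ ^ 2 ≤ 4 * colSq (fundSol (potential α Λ S) z k
        * Matrix.fromRows φ (1 : Matrix (Fin m₂) (Fin m₂) ℂ)) a := by
      intro k
      obtain ⟨hSk, hlk, -⟩ := isStronglyAdmissible_toCols_iff.1 (h.seq hi k)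
      rw [← hwc, ← Matrix.mul_assoc, h.fundSol_mul_transfer hi hz, Matrix.mul_assoc]
      refine le_trans ?_ (le_colSq_transfer_mul hSk hlk hzu hzt _ a)
      refine le_trans ?_ (sq_norm_le_colSq _ (Sum.inl i) a)
      have : ((1 + (Complex.I / z) • sig m₁ m₂) ^ k * c :
          Matrix (Fin m₁ ⊕ Fin m₂) (Fin m₂) ℂ) (Sum.inl i) a
          = (1 + Complex.I / z) ^ k * c (Sum.inl i) a := by
        rw [one_add_smul_sig_pow]
        simp [Matrix.mul_apply, Fintype.sum_sum_type, Matrix.one_apply]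
      rw [this, norm_mul, norm_pow, mul_pow]
      exact le_mul_of_one_le_left (sq_nonneg _)
        (one_le_pow₀ (one_le_pow₀ (one_le_norm_one_add_I_div hz)))
    have hlim := hsum.tendsto_atTop_zero.const_mul 4
    rw [mul_zero] at hlim
    have := ge_of_tendsto' hlim hb
    have h0 : ‖c (Sum.inl i) a‖ = 0 := by
      nlinarith [norm_nonneg (c (Sum.inl i) a)]
    exact norm_eq_zero.1 h0
  have hc2 : c = Matrix.fromRows (0 : Matrix (Fin m₁) (Fin m₂) ℂ) c.toRows₂ := by
    ext i a
    rcases i with i | i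
    · simp [hc1]
    · simp
  rw [hc2] at hwc
  exact transfer_mul_fromRows_zero_unique hwc hX

end

/-! ### Meromorphy of resolvents and the identity theorem. -/

section Meromorphic

open Filter Topology

theorem differentiable_det {M : ℂ → Matrix (Fin n) (Fin n) ℂ}
    (hM : ∀ i j, Differentiable ℂ fun z => M z i j) : Differentiable ℂ fun z => (M z).det := by
  simp_rw [Matrix.det_apply]
  refine Differentiable.fun_sum fun σ _ => Differentiable.fun_const_smul ?_ _
  exact Differentiable.fun_finsetProd fun i _ => hM _ _

/-- Cramer's rule: adjugate over determinant, both entire. Where the determinant vanishes, the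
default inverse `0` agrees with `0⁻¹ = 0`. -/
theorem meromorphicOn_resolvent (B : Matrix (Fin n) (Fin n) ℂ) (i j : Fin n) (U : Set ℂ) :
    MeromorphicOn (fun z => (z • 1 + B)⁻¹ i j) U := by
  have hent : ∀ i j, Differentiable ℂ fun z : ℂ => (z • 1 + B) i j := by
    intro i j
    simp only [Matrix.add_apply, Matrix.smul_apply, smul_eq_mul]
    fun_prop
  have hadj : Differentiable ℂ fun z : ℂ => (z • 1 + B).adjugate i j := by
    simp_rw [Matrix.adjugate_apply]
    refine differentiable_det fun k l => ?_
    simp only [Matrix.updateRow_apply]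
    split_ifs
    · fun_prop
    · exact hent k l
  have hdet := differentiable_det hent
  simp_rw [Matrix.inv_def, Ring.inverse_eq_inv', Matrix.smul_apply, smul_eq_mul]
  intro z _
  exact (hdet.analyticAt z).meromorphicAt.inv.mul (hadj.analyticAt z).meromorphicAt

theorem meromorphicOn_mul_resolvent_mul {p q : ℕ} (P : Matrix (Fin p) (Fin n) ℂ)
    (B : Matrix (Fin n) (Fin n) ℂ) (Q : Matrix (Fin n) (Fin q) ℂ) (i : Fin p) (j : Fin q)
    (U : Set ℂ) :
    MeromorphicOn (fun z => (P * (z • 1 + B)⁻¹ * Q : Matrix (Fin p) (Fin q) ℂ) i j) U := by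
  simp_rw [Matrix.mul_apply]
  refine fun z hz => MeromorphicAt.fun_sum fun k _ => MeromorphicAt.fun_mul ?_ (.const _ _)
  refine MeromorphicAt.fun_sum fun l _ => MeromorphicAt.fun_mul (.const _ _) ?_
  exact meromorphicOn_resolvent B l k U z hz

theorem eventually_isUnit_smul_one_add (B : Matrix (Fin n) (Fin n) ℂ) (U : Set ℂ) :
    ∀ᶠ z in codiscreteWithin U, IsUnit (z • 1 + B) := by
  filter_upwards [compl_finite_mem_codiscreteWithin (s := U) (Matrix.finite_spectrum (-B))]
    with z hz
  have := sub_smul_isUnit_of_notMem_spectrum hz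
  simpa [add_comm] using this.neg

/-- The identity theorem: a meromorphic function on a connected set which vanishes near a point
vanishes off a discrete set. -/
theorem eventually_codiscreteWithin_eq_zero {f : ℂ → ℂ} {U : Set ℂ} (hf : MeromorphicOn f U)
    (hU : IsConnected U) {z₀ : ℂ} (hz₀ : z₀ ∈ U) (h : ∀ᶠ z in 𝓝[≠] z₀, f z = 0) :
    ∀ᶠ z in codiscreteWithin U, f z = 0 := by
  have h0 : meromorphicOrderAt f z₀ = ⊤ := meromorphicOrderAt_eq_top_iff.2 h
  have hall : ∀ u : U, meromorphicOrderAt f u = ⊤ := by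
    by_contra! hcon
    exact (hf.exists_meromorphicOrderAt_ne_top_iff_forall hU).1 hcon ⟨z₀, hz₀⟩ h0
  rw [Filter.Eventually, mem_codiscreteWithin_iff_forall_mem_nhdsNE]
  intro z hz
  filter_upwards [meromorphicOrderAt_eq_top_iff.1 (hall ⟨z, hz⟩)] with w hw
  exact Or.inl hw

theorem isOpen_halfPlane (M : ℝ) : IsOpen (halfPlane M) :=
  isOpen_lt continuous_const Complex.continuous_im

theorem isConnected_halfPlane (M : ℝ) : IsConnected (halfPlane M) :=
  ⟨⟨⟨0, M + 1⟩, show M < M + 1 by linarith⟩, (convex_halfSpace_im_gt M).isPreconnected⟩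

end Meromorphic

/-! ### The Weyl function: existence and uniqueness. -/

section

open Filter Topology

variable {α S : Matrix (Fin n) (Fin n) ℂ} {Λ : Matrix (Fin n) (Fin m₁ ⊕ Fin m₂) ℂ}

theorem meromorphicOn_weylState (a : Fin m₁) (b : Fin m₂) (U : Set ℂ) :
    MeromorphicOn (fun z => weylState α S Λ z a b) U := by
  simp only [weylState, Matrix.smul_apply, smul_eq_mul]
  exact MeromorphicOn.fun_mul (MeromorphicOn.const _) (meromorphicOn_mul_resolvent_mul _ _ _ _ _ _)

theorem IsStronglyAdmissible.isWeylFunction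
    (h : IsStronglyAdmissible α S Λ.toCols₁ Λ.toCols₂) (hi : Complex.I ∉ spectrum ℂ α) :
    IsWeylFunction (1 / 2) (potential α Λ S) (weylState α S Λ) where
  pos := by norm_num
  meromorphic a b := meromorphicOn_weylState a b _
  summable := by
    filter_upwards [self_mem_codiscreteWithin (halfPlane (1 / 2)),
      eventually_isUnit_smul_one_add
        (α - Complex.I • (Λ.toCols₂ * Λ.toCols₂ᴴ * S⁻¹)) _] with z hz hβ
    exact h.weylSummable hi hz hβ

theorem IsStronglyAdmissible.weylFunction_unique
    (h : IsStronglyAdmissible α S Λ.toCols₁ Λ.toCols₂) (hi : Complex.I ∉ spectrum ℂ α)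
    {M : ℝ} {φ : ℂ → Matrix (Fin m₁) (Fin m₂) ℂ} (hφ : IsWeylFunction M (potential α Λ S) φ) :
    ∀ᶠ z in codiscreteWithin (halfPlane M), φ z = weylState α S Λ z := by
  -- Pointwise uniqueness is available only above this height; the identity theorem, entry by entry,
  -- carries it down to `M`.
  set R := max M (4 * α.trace.im) with hR
  have hloc : ∀ᶠ z in codiscreteWithin (halfPlane R), φ z = weylState α S Λ z := by
    have hsub : halfPlane R ⊆ halfPlane M := fun z hz =>
      show M < z.im from (le_max_left _ _).trans_lt (show R < z.im from hz)
    filter_upwards [self_mem_codiscreteWithin (halfPlane R),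
      codiscreteWithin_mono hsub hφ.summable, eventually_isUnit_smul_one_add
        (α - Complex.I • (Λ.toCols₂ * Λ.toCols₂ᴴ * S⁻¹)) _] with z hz hs hβ
    have hz' : R < z.im := hz
    exact h.eq_weylState hi (hφ.pos.trans ((le_max_left _ _).trans_lt hz'))
      ((le_max_right _ _).trans hz'.le) hβ hs
  have hz₀R : (⟨0, R + 1⟩ : ℂ) ∈ halfPlane R := show R < R + 1 by linarith
  have hz₀M : (⟨0, R + 1⟩ : ℂ) ∈ halfPlane M :=
    show M < R + 1 by linarith [le_max_left M (4 * α.trace.im)]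
  have hnear : ∀ᶠ z in 𝓝[≠] (⟨0, R + 1⟩ : ℂ), φ z = weylState α S Λ z := by
    have h1 := mem_codiscreteWithin_iff_forall_mem_nhdsNE.1 hloc _ hz₀R
    filter_upwards [h1, nhdsWithin_le_nhds ((isOpen_halfPlane R).mem_nhds hz₀R)] with z hz hzR
    exact hz.resolve_right fun hc => hc hzR
  have hent : ∀ a b, ∀ᶠ z in codiscreteWithin (halfPlane M),
      φ z a b - weylState α S Λ z a b = 0 := by
    intro a b
    refine eventually_codiscreteWithin_eq_zero
      ((hφ.meromorphic a b).fun_sub (meromorphicOn_weylState a b _)) (isConnected_halfPlane M)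
      hz₀M ?_
    filter_upwards [hnear] with z hz
    rw [hz, sub_self]
  filter_upwards [eventually_all.2 fun a => eventually_all.2 fun b => hent a b] with z hz
  ext a b
  exact sub_eq_zero.1 (hz a b)

end

/-! ### Linear matrix differential equations. -/

section Calculus

theorem hasDerivAt_matrix_iff {ι κ : Type*} [Fintype ι] [Fintype κ] {F : ℝ → Matrix ι κ ℂ}
    {F' : Matrix ι κ ℂ} {t : ℝ} :
    HasDerivAt F F' t ↔ ∀ i j, HasDerivAt (fun s => F s i j) (F' i j) t :=
  hasDerivAt_pi.trans (forall_congr' fun _ => hasDerivAt_pi)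

theorem HasDerivAt.matrixMul {ι κ l : Type*} [Fintype ι] [Fintype κ] [Fintype l]
    {F : ℝ → Matrix ι κ ℂ} {G : ℝ → Matrix κ l ℂ} {F' : Matrix ι κ ℂ} {G' : Matrix κ l ℂ} {t : ℝ}
    (hF : HasDerivAt F F' t) (hG : HasDerivAt G G' t) :
    HasDerivAt (fun s => F s * G s) (F' * G t + F t * G') t := by
  rw [hasDerivAt_matrix_iff] at *
  intro i j
  simp only [Matrix.mul_apply, Matrix.add_apply, ← Finset.sum_add_distrib]
  exact HasDerivAt.fun_sum fun k _ => (hF i k).mul (hG k j)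

theorem HasDerivAt.matrixConjTranspose {ι κ : Type*} [Fintype ι] [Fintype κ]
    {F : ℝ → Matrix ι κ ℂ} {F' : Matrix ι κ ℂ} {t : ℝ} (hF : HasDerivAt F F' t) :
    HasDerivAt (fun s => (F s)ᴴ) F'ᴴ t := by
  rw [hasDerivAt_matrix_iff] at *
  intro i j
  exact (hF j i).star

open scoped Matrix.Norms.Operator in
theorem HasDerivAt.matrixLinearMap
    (T : Matrix (Fin n) (Fin n) ℂ →ₗ[ℂ] Matrix (Fin n) (Fin n) ℂ)
    {F : ℝ → Matrix (Fin n) (Fin n) ℂ} {F' : Matrix (Fin n) (Fin n) ℂ} {t : ℝ}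
    (hF : HasDerivAt F F' t) : HasDerivAt (fun s => T (F s)) (T F') t :=
  (LinearMap.toContinuousLinearMap (T.restrictScalars ℝ)).hasFDerivAt.comp_hasDerivAt t hF

open scoped Matrix.Norms.Operator in
theorem hasDerivAt_exp_smul (A : Matrix (Fin n) (Fin n) ℂ) (t : ℝ) :
    HasDerivAt (fun s : ℝ => NormedSpace.exp ((s : ℂ) • A))
      (A * NormedSpace.exp ((t : ℂ) • A)) t := by
  have := hasDerivAt_exp_smul_const' (𝕂 := ℝ) A t
  simp only [Complex.coe_smul]
  exact this

open scoped Matrix.Norms.Operator in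
theorem commute_exp {A B : Matrix (Fin n) (Fin n) ℂ} (h : Commute A B) :
    Commute A (NormedSpace.exp B) :=
  h.exp_right

theorem exp_neg_smul_mul_exp_smul (A : Matrix (Fin n) (Fin n) ℂ) (t : ℂ) :
    NormedSpace.exp (t • (-A)) * NormedSpace.exp (t • A) = 1 := by
  rw [← Matrix.exp_add_of_commute _ _ (by simp [Commute, SemiconjBy])]
  simp

/-- The solution of the linear equation `X' = A X + X B`. -/
theorem eq_exp_mul_mul_exp {A : Matrix (Fin n) (Fin n) ℂ} {B : Matrix (Fin m) (Fin m) ℂ}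
    {X : ℝ → Matrix (Fin n) (Fin m) ℂ} (hX : ∀ t, HasDerivAt X (A * X t + X t * B) t) (t : ℝ) :
    X t = NormedSpace.exp ((t : ℂ) • A) * X 0 * NormedSpace.exp ((t : ℂ) • B) := by
  -- Undoing the expected exponentials on both sides leaves a function with zero derivative.
  set W : ℝ → Matrix (Fin n) (Fin m) ℂ := fun s =>
    NormedSpace.exp ((s : ℂ) • (-A)) * X s * NormedSpace.exp ((s : ℂ) • (-B)) with hW
  have hd : ∀ s, HasDerivAt W 0 s := by
    intro s
    have h := HasDerivAt.matrixMul (HasDerivAt.matrixMul (hasDerivAt_exp_smul (-A) s) (hX s))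
      (hasDerivAt_exp_smul (-B) s)
    convert h using 1
    have c1 : A * NormedSpace.exp ((s : ℂ) • (-A)) = NormedSpace.exp ((s : ℂ) • (-A)) * A :=
      (commute_exp (by simp [Commute, SemiconjBy])).eq
    simp only [Matrix.neg_mul, c1, Matrix.add_mul, Matrix.mul_add, Matrix.mul_neg,
      Matrix.mul_assoc]
    abel
  have hconst : W t = W 0 := by
    ext i j
    exact is_const_of_deriv_eq_zero (f := fun s => W s i j)
      (fun s => (hasDerivAt_matrix_iff.1 (hd s) i j).differentiableAt)
      (fun s => (hasDerivAt_matrix_iff.1 (hd s) i j).deriv) t 0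
  have h0 : W 0 = X 0 := by simp [hW]
  rw [← h0, ← hconst, hW]
  have e1 := exp_neg_smul_mul_exp_smul (-A) t
  have e2 := exp_neg_smul_mul_exp_smul B t
  rw [neg_neg] at e1
  simp only [Matrix.mul_assoc, e2, Matrix.mul_one]
  rw [← Matrix.mul_assoc, e1, Matrix.one_mul]

end Calculus

/-! ### Algebra of the evolution equations. -/

section Algebra

theorem mul_proj₁ (Λ : Matrix (Fin n) (Fin m₁ ⊕ Fin m₂) ℂ) :
    Λ * proj₁ m₁ m₂ = Matrix.fromCols Λ.toCols₁ 0 := by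
  rw [proj₁, Matrix.mul_smul, Matrix.mul_add, mul_sig, Matrix.mul_one]
  ext i j
  rcases j with j | j
  · simp; ring
  · simp

theorem mul_proj₂ (Λ : Matrix (Fin n) (Fin m₁ ⊕ Fin m₂) ℂ) :
    Λ * proj₂ m₁ m₂ = Matrix.fromCols 0 Λ.toCols₂ := by
  rw [proj₂, Matrix.mul_smul, Matrix.mul_sub, mul_sig, Matrix.mul_one]
  ext i j
  rcases j with j | j
  · simp
  · simp; ring

theorem evolution_lam_eq (a b : Matrix (Fin n) (Fin n) ℂ)
    (Λ : Matrix (Fin n) (Fin m₁ ⊕ Fin m₂) ℂ) :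
    (-2 : ℂ) • (a * Λ * proj₁ m₁ m₂ + b * Λ * proj₂ m₁ m₂)
      = Matrix.fromCols ((-2 : ℂ) • a * Λ.toCols₁) ((-2 : ℂ) • b * Λ.toCols₂) := by
  rw [Matrix.mul_assoc, Matrix.mul_assoc, mul_proj₁, mul_proj₂, Matrix.mul_fromCols,
    Matrix.mul_fromCols]
  ext i j
  rcases j with j | j <;> simp

variable {α : Matrix (Fin n) (Fin n) ℂ}

/-- The quadratic term of the evolution of `S` in terms of the two resolvents. -/
theorem evolution_quadratic_term {a b γ a' b' d d' X : Matrix (Fin n) (Fin n) ℂ}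
    (hα : d * α = (1 / 2 : ℂ) • (a + b)) (hγ : γ * d' = (1 / 2 : ℂ) • (a' + b'))
    (hd : d = (-(Complex.I / 2)) • (a - b)) (hd' : d' = (Complex.I / 2) • (a' - b')) :
    (2 : ℂ) • (d * (α * X + X * γ) * d') = Complex.I • (b * X * a' - a * X * b') := by
  have : d * (α * X + X * γ) * d' = (d * α) * X * d' + d * X * (γ * d') := by noncomm_ring
  rw [this, hα, hγ, hd, hd']
  simp only [Matrix.smul_mul, Matrix.mul_smul, Matrix.mul_add, Matrix.add_mul, Matrix.mul_sub,
    Matrix.sub_mul, smul_smul, smul_add, smul_sub]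
  module

/-- Here `a, b, a', b'` play the roles of `(α - i)⁻¹`, `(α + i)⁻¹`, `(γ + i)⁻¹`, `(γ - i)⁻¹`, with
`γ = α*`. Under `X ↦ α X - X γ` the linear terms produce `Q₁ + Q₂` and the quadratic ones `±(Q₁ -
Q₂)`, so the mixed products cancel. -/
theorem sylvester_evolution {γ a b a' b' S Q₁ Q₂ : Matrix (Fin n) (Fin n) ℂ}
    (ha : α * a = 1 + Complex.I • a) (ha2 : a * α = 1 + Complex.I • a)
    (hb : α * b = 1 - Complex.I • b) (hb2 : b * α = 1 - Complex.I • b)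
    (ha' : a' * γ = 1 - Complex.I • a') (ha2' : γ * a' = 1 - Complex.I • a')
    (hb' : b' * γ = 1 + Complex.I • b') (hb2' : γ * b' = 1 + Complex.I • b')
    (hl : α * S - S * γ = Complex.I • (Q₁ + Q₂)) :
    α * -(a * S + b * S + S * a' + S * b'
        + Complex.I • (b * (Q₁ - Q₂) * a' - a * (Q₁ - Q₂) * b'))
      - -(a * S + b * S + S * a' + S * b'
        + Complex.I • (b * (Q₁ - Q₂) * a' - a * (Q₁ - Q₂) * b')) * γ
      = Complex.I • ((-2 : ℂ) • (a * Q₁ + b * Q₂) + (-2 : ℂ) • (Q₁ * a' + Q₂ * b')) := by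
  have t1 : α * (a * S) - (a * S) * γ = Complex.I • (a * (Q₁ + Q₂)) := by
    rw [← Matrix.mul_smul, ← hl, ← Matrix.mul_assoc, ha, ← ha2]; noncomm_ring
  have t2 : α * (b * S) - (b * S) * γ = Complex.I • (b * (Q₁ + Q₂)) := by
    rw [← Matrix.mul_smul, ← hl, ← Matrix.mul_assoc, hb, ← hb2]; noncomm_ring
  have t3 : α * (S * a') - (S * a') * γ = Complex.I • ((Q₁ + Q₂) * a') := by
    rw [← Matrix.smul_mul, ← hl, Matrix.mul_assoc, ha', ← ha2']; noncomm_ring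
  have t4 : α * (S * b') - (S * b') * γ = Complex.I • ((Q₁ + Q₂) * b') := by
    rw [← Matrix.smul_mul, ← hl, Matrix.mul_assoc, hb', ← hb2']; noncomm_ring
  have t5 : α * (b * (Q₁ - Q₂) * a') - (b * (Q₁ - Q₂) * a') * γ
      = (Q₁ - Q₂) * a' - b * (Q₁ - Q₂) := by
    rw [Matrix.mul_assoc (b * (Q₁ - Q₂)), ha', ← Matrix.mul_assoc, ← Matrix.mul_assoc, hb]
    simp only [Matrix.sub_mul, Matrix.mul_sub, Matrix.one_mul, Matrix.mul_one, Matrix.smul_mul,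
      Matrix.mul_smul]
    module
  have t6 : α * (a * (Q₁ - Q₂) * b') - (a * (Q₁ - Q₂) * b') * γ
      = (Q₁ - Q₂) * b' - a * (Q₁ - Q₂) := by
    rw [Matrix.mul_assoc (a * (Q₁ - Q₂)), hb', ← Matrix.mul_assoc, ← Matrix.mul_assoc, ha]
    simp only [Matrix.sub_mul, Matrix.mul_sub, Matrix.one_mul, Matrix.mul_one, Matrix.smul_mul,
      Matrix.mul_smul, Matrix.add_mul, Matrix.mul_add]
    module
  have hsum : α * -(a * S + b * S + S * a' + S * b'
        + Complex.I • (b * (Q₁ - Q₂) * a' - a * (Q₁ - Q₂) * b'))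
      - -(a * S + b * S + S * a' + S * b'
        + Complex.I • (b * (Q₁ - Q₂) * a' - a * (Q₁ - Q₂) * b')) * γ
      = -((α * (a * S) - (a * S) * γ) + (α * (b * S) - (b * S) * γ)
        + (α * (S * a') - (S * a') * γ) + (α * (S * b') - (S * b') * γ)
        + Complex.I • ((α * (b * (Q₁ - Q₂) * a') - (b * (Q₁ - Q₂) * a') * γ)
          - (α * (a * (Q₁ - Q₂) * b') - (a * (Q₁ - Q₂) * b') * γ))) := by
    generalize b * (Q₁ - Q₂) * a' = u
    generalize a * (Q₁ - Q₂) * b' = v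
    generalize a * S = p
    generalize b * S = q
    generalize S * a' = r
    generalize S * b' = s
    simp only [Matrix.mul_neg, Matrix.neg_mul, Matrix.mul_add, Matrix.add_mul, Matrix.mul_smul,
      Matrix.smul_mul, Matrix.mul_sub, Matrix.sub_mul]
    module
  rw [hsum, t1, t2, t3, t4, t5, t6]
  simp only [Matrix.mul_add, Matrix.add_mul, Matrix.mul_sub, Matrix.sub_mul]
  module

end Algebra

/-! ### Resolvent identities at `±i`. -/

section Resolvents

variable {α : Matrix (Fin n) (Fin n) ℂ}

theorem mul_inv_sub_smul {c : ℂ} (h : IsUnit (α - c • 1)) :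
    α * (α - c • 1)⁻¹ = 1 + c • (α - c • 1)⁻¹ := by
  have := Matrix.mul_nonsing_inv _ ((Matrix.isUnit_iff_isUnit_det _).1 h)
  rw [Matrix.sub_mul, Matrix.smul_mul, Matrix.one_mul] at this
  exact eq_add_of_sub_eq this

theorem inv_sub_smul_mul {c : ℂ} (h : IsUnit (α - c • 1)) :
    (α - c • 1)⁻¹ * α = 1 + c • (α - c • 1)⁻¹ := by
  have := Matrix.nonsing_inv_mul _ ((Matrix.isUnit_iff_isUnit_det _).1 h)
  rw [Matrix.mul_sub, Matrix.mul_smul, Matrix.mul_one] at this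
  exact eq_add_of_sub_eq this

theorem commute_inv_sub_smul {c : ℂ} (h : IsUnit (α - c • 1)) : Commute α (α - c • 1)⁻¹ :=
  (mul_inv_sub_smul h).trans (inv_sub_smul_mul h).symm

/-- Partial fractions for `1 / (s² + 1)`; the next lemma is the case `s / (s² + 1)`. -/
theorem inv_sq_add_one (h₁ : IsUnit (α - Complex.I • 1)) (h₂ : IsUnit (α + Complex.I • 1)) :
    (α ^ 2 + 1)⁻¹ = (-(Complex.I / 2)) • ((α - Complex.I • 1)⁻¹ - (α + Complex.I • 1)⁻¹) := by
  have h₂' : IsUnit (α - (-Complex.I) • 1) := by simpa using h₂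
  have e1 := mul_inv_sub_smul h₁
  have e2 := mul_inv_sub_smul h₂'
  rw [neg_smul, sub_neg_eq_add] at e2
  refine Matrix.inv_eq_right_inv ?_
  generalize (α - Complex.I • 1)⁻¹ = a at *
  generalize (α + Complex.I • 1)⁻¹ = b at *
  have q1 : (α ^ 2 + 1) * a = α + Complex.I • 1 := by
    rw [sq, Matrix.add_mul, Matrix.mul_assoc, e1, Matrix.mul_add, Matrix.mul_smul, e1,
      Matrix.mul_one, smul_add, smul_smul, Complex.I_mul_I, Matrix.one_mul]
    module
  have q2 : (α ^ 2 + 1) * b = α - Complex.I • 1 := by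
    rw [sq, Matrix.add_mul, Matrix.mul_assoc, e2, Matrix.mul_add, Matrix.mul_smul, e2,
      Matrix.mul_one, smul_add, smul_smul, neg_mul_neg, Complex.I_mul_I, Matrix.one_mul]
    module
  rw [Matrix.mul_smul, Matrix.mul_sub, q1, q2, add_sub_sub_cancel, ← add_smul, smul_smul,
    show -(Complex.I / 2) * (Complex.I + Complex.I) = 1 by
      linear_combination -Complex.I_mul_I, one_smul]

theorem inv_sq_add_one_mul (h₁ : IsUnit (α - Complex.I • 1)) (h₂ : IsUnit (α + Complex.I • 1)) :
    (α ^ 2 + 1)⁻¹ * α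
      = (1 / 2 : ℂ) • ((α - Complex.I • 1)⁻¹ + (α + Complex.I • 1)⁻¹) := by
  have h₂' : IsUnit (α - (-Complex.I) • 1) := by simpa using h₂
  have e1 := inv_sub_smul_mul h₁
  have e2 := inv_sub_smul_mul h₂'
  rw [neg_smul, sub_neg_eq_add] at e2
  rw [inv_sq_add_one h₁ h₂, Matrix.smul_mul, Matrix.sub_mul, e1, e2, add_sub_add_left_eq_sub,
    smul_sub, smul_smul, smul_smul, show -(Complex.I / 2) * Complex.I = 1 / 2 by
      linear_combination (-1 / 2 : ℂ) * Complex.I_mul_I,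
    show -(Complex.I / 2) * -Complex.I = -(1 / 2) by
      linear_combination (1 / 2 : ℂ) * Complex.I_mul_I]
  module

end Resolvents

/-- The right-hand side of the evolution equation for `S`. -/
noncomputable def evolS (α S : Matrix (Fin n) (Fin n) ℂ)
    (Λ : Matrix (Fin n) (Fin m₁ ⊕ Fin m₂) ℂ) : Matrix (Fin n) (Fin n) ℂ :=
  -((α - Complex.I • 1)⁻¹ * S + (α + Complex.I • 1)⁻¹ * S
      + S * (αᴴ + Complex.I • 1)⁻¹ + S * (αᴴ - Complex.I • 1)⁻¹
      + (2 : ℂ) • ((α ^ 2 + 1)⁻¹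
        * (α * Λ * sig m₁ m₂ * Λᴴ + Λ * sig m₁ m₂ * Λᴴ * αᴴ)
        * (αᴴ ^ 2 + 1)⁻¹))

theorem conjTranspose_sub_smul_one (α : Matrix (Fin n) (Fin n) ℂ) (c : ℂ) :
    (α - c • 1)ᴴ = αᴴ - star c • 1 := by
  rw [Matrix.conjTranspose_sub, Matrix.conjTranspose_smul, Matrix.conjTranspose_one]

section

variable {α S : Matrix (Fin n) (Fin n) ℂ} {Λ : Matrix (Fin n) (Fin m₁ ⊕ Fin m₂) ℂ}

/-- The evolution equation of `S` is the derivative of the Lyapunov identity, solved for `S'`. -/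
theorem sylvester_evolS (h₁ : IsUnit (α - Complex.I • 1)) (h₂ : IsUnit (α + Complex.I • 1))
    (hl : α * S - S * αᴴ = Complex.I • (Λ * Λᴴ)) {Λ' : Matrix (Fin n) (Fin m₁ ⊕ Fin m₂) ℂ}
    (hΛ' : Λ' = (-2 : ℂ) • ((α - Complex.I • 1)⁻¹ * Λ * proj₁ m₁ m₂
      + (α + Complex.I • 1)⁻¹ * Λ * proj₂ m₁ m₂)) :
    α * evolS α S Λ - evolS α S Λ * αᴴ = Complex.I • (Λ' * Λᴴ + Λ * Λ'ᴴ) := by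
  have h₂' : IsUnit (α - (-Complex.I) • 1) := by simpa using h₂
  have hc₁ : (α - Complex.I • 1)ᴴ = αᴴ + Complex.I • 1 := by
    rw [conjTranspose_sub_smul_one]; simp
  have hc₂ : (α + Complex.I • 1)ᴴ = αᴴ - Complex.I • 1 := by
    simp [Matrix.conjTranspose_add, sub_eq_add_neg]
  have k₁ : IsUnit (αᴴ + Complex.I • 1) := hc₁ ▸ h₁.star
  have k₂ : IsUnit (αᴴ - Complex.I • 1) := hc₂ ▸ h₂.star
  have k₁' : IsUnit (αᴴ - (-Complex.I) • 1) := by simpa using k₁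
  have ea := mul_inv_sub_smul h₁
  have ea2 := inv_sub_smul_mul h₁
  have eb := mul_inv_sub_smul h₂'
  have eb2 := inv_sub_smul_mul h₂'
  have ea' := inv_sub_smul_mul k₁'
  have ea2' := mul_inv_sub_smul k₁'
  have eb' := inv_sub_smul_mul k₂
  have eb2' := mul_inv_sub_smul k₂
  simp only [neg_smul, sub_neg_eq_add, ← sub_eq_add_neg] at eb eb2 ea' ea2'
  have d1 := inv_sq_add_one h₁ h₂
  have d2 := inv_sq_add_one_mul h₁ h₂
  have d1' := inv_sq_add_one k₂ k₁
  have d2' : αᴴ * (αᴴ ^ 2 + 1)⁻¹ =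
      (1 / 2 : ℂ) • ((αᴴ + Complex.I • 1)⁻¹ + (αᴴ - Complex.I • 1)⁻¹) := by
    have := congrArg Matrix.conjTranspose d2
    simpa [Matrix.conjTranspose_mul, Matrix.conjTranspose_nonsing_inv, Matrix.conjTranspose_smul,
      hc₁, hc₂, Matrix.conjTranspose_pow] using this
  have d1'' : (αᴴ ^ 2 + 1)⁻¹
      = (Complex.I / 2) • ((αᴴ + Complex.I • 1)⁻¹ - (αᴴ - Complex.I • 1)⁻¹) := by
    rw [d1']; module
  have hX : α * Λ * sig m₁ m₂ * Λᴴ + Λ * sig m₁ m₂ * Λᴴ * αᴴ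
      = α * (Λ * sig m₁ m₂ * Λᴴ) + (Λ * sig m₁ m₂ * Λᴴ) * αᴴ := by
    simp only [Matrix.mul_assoc]
  have hQ := mul_conjTranspose_eq_toCols Λ
  rw [hQ] at hl
  rw [evolS, hX, evolution_quadratic_term d2 d2' d1 d1'', mul_sig_mul_conjTranspose_eq_toCols,
    sylvester_evolution ea ea2 eb eb2 ea' ea2' eb' eb2' hl]
  have l1 : Λ' * Λᴴ = (-2 : ℂ) • ((α - Complex.I • 1)⁻¹ * (Λ.toCols₁ * Λ.toCols₁ᴴ)
      + (α + Complex.I • 1)⁻¹ * (Λ.toCols₂ * Λ.toCols₂ᴴ)) := by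
    rw [hΛ', evolution_lam_eq]
    conv_lhs => rw [← Matrix.fromCols_toCols Λ,
      Matrix.conjTranspose_fromCols_eq_fromRows_conjTranspose, Matrix.fromCols_mul_fromRows]
    simp [Matrix.mul_assoc]
  have l2 : Λ * Λ'ᴴ = (-2 : ℂ) • ((Λ.toCols₁ * Λ.toCols₁ᴴ) * (αᴴ + Complex.I • 1)⁻¹
      + (Λ.toCols₂ * Λ.toCols₂ᴴ) * (αᴴ - Complex.I • 1)⁻¹) := by
    have := congrArg Matrix.conjTranspose l1
    simpa [Matrix.conjTranspose_mul, Matrix.conjTranspose_nonsing_inv, hc₁, hc₂, Matrix.mul_assoc]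
      using this
  rw [l1, l2]

/-- The term quadratic in `Λ` cancels, leaving a homogeneous equation `X' = A X + X B`, which yields
uniqueness. -/
theorem evolS_sub (S T : Matrix (Fin n) (Fin n) ℂ) :
    evolS α S Λ - evolS α T Λ
      = -((α - Complex.I • 1)⁻¹ + (α + Complex.I • 1)⁻¹) * (S - T)
        + (S - T) * -((αᴴ + Complex.I • 1)⁻¹ + (αᴴ - Complex.I • 1)⁻¹) := by
  simp only [evolS, Matrix.neg_mul, Matrix.mul_neg, Matrix.add_mul, Matrix.mul_add, Matrix.mul_sub,
    Matrix.sub_mul]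
  abel

end

/-- The explicit solution `Λ(t)` of the evolution equation. -/
noncomputable def lamEvol (α : Matrix (Fin n) (Fin n) ℂ) (θ₁ : Matrix (Fin n) (Fin m₁) ℂ)
    (θ₂ : Matrix (Fin n) (Fin m₂) ℂ) (t : ℝ) : Matrix (Fin n) (Fin m₁ ⊕ Fin m₂) ℂ :=
  Matrix.fromCols (NormedSpace.exp ((-2 * t : ℂ) • (α - Complex.I • 1)⁻¹) * θ₁)
    (NormedSpace.exp ((-2 * t : ℂ) • (α + Complex.I • 1)⁻¹) * θ₂)

theorem hasDerivAt_exp_neg_two_mul {p : ℕ} (a : Matrix (Fin n) (Fin n) ℂ)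
    (θ : Matrix (Fin n) (Fin p) ℂ) (t : ℝ) :
    HasDerivAt (fun s : ℝ => NormedSpace.exp ((-2 * s : ℂ) • a) * θ)
      ((-2 : ℂ) • a * (NormedSpace.exp ((-2 * t : ℂ) • a) * θ)) t := by
  have h := HasDerivAt.matrixMul (hasDerivAt_exp_smul ((-2 : ℂ) • a) t)
    (hasDerivAt_matrix_iff (F := fun _ => θ) (F' := 0).2 fun i j => hasDerivAt_const t (θ i j))
  simp only [smul_smul, mul_comm _ (-2 : ℂ)] at h
  convert h using 1
  rw [Matrix.mul_zero, add_zero, Matrix.mul_assoc]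

theorem hasDerivAt_lamEvol (α : Matrix (Fin n) (Fin n) ℂ) (θ₁ : Matrix (Fin n) (Fin m₁) ℂ)
    (θ₂ : Matrix (Fin n) (Fin m₂) ℂ) (t : ℝ) :
    HasDerivAt (lamEvol α θ₁ θ₂)
      ((-2 : ℂ) • ((α - Complex.I • 1)⁻¹ * lamEvol α θ₁ θ₂ t * proj₁ m₁ m₂
        + (α + Complex.I • 1)⁻¹ * lamEvol α θ₁ θ₂ t * proj₂ m₁ m₂)) t := by
  rw [evolution_lam_eq, hasDerivAt_matrix_iff]
  intro i j
  rcases j with j | j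
  · exact hasDerivAt_matrix_iff.1 (hasDerivAt_exp_neg_two_mul _ θ₁ t) i j
  · exact hasDerivAt_matrix_iff.1 (hasDerivAt_exp_neg_two_mul _ θ₂ t) i j

/-- The projections decouple the two column blocks; each satisfies a linear equation with constant
coefficients. -/
theorem IsTimeEvolution.lam_eq {α S₀ : Matrix (Fin n) (Fin n) ℂ} {θ₁ : Matrix (Fin n) (Fin m₁) ℂ}
    {θ₂ : Matrix (Fin n) (Fin m₂) ℂ} {Λ : ℝ → Matrix (Fin n) (Fin m₁ ⊕ Fin m₂) ℂ}
    {S : ℝ → Matrix (Fin n) (Fin n) ℂ} (h : IsTimeEvolution α S₀ θ₁ θ₂ Λ S) :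
    Λ = lamEvol α θ₁ θ₂ := by
  have hd := h.lam_deriv
  simp_rw [evolution_lam_eq] at hd
  have h1 : ∀ t, HasDerivAt (fun s => (Λ s).toCols₁)
      ((-2 : ℂ) • (α - Complex.I • 1)⁻¹ * (Λ t).toCols₁
        + (Λ t).toCols₁ * (0 : Matrix (Fin m₁) (Fin m₁) ℂ)) t := by
    intro t
    rw [Matrix.mul_zero, add_zero, hasDerivAt_matrix_iff]
    exact fun i j => hasDerivAt_matrix_iff.1 (hd t) i (Sum.inl j)
  have h2 : ∀ t, HasDerivAt (fun s => (Λ s).toCols₂)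
      ((-2 : ℂ) • (α + Complex.I • 1)⁻¹ * (Λ t).toCols₂
        + (Λ t).toCols₂ * (0 : Matrix (Fin m₂) (Fin m₂) ℂ)) t := by
    intro t
    rw [Matrix.mul_zero, add_zero, hasDerivAt_matrix_iff]
    exact fun i j => hasDerivAt_matrix_iff.1 (hd t) i (Sum.inr j)
  funext t
  have e1 := eq_exp_mul_mul_exp h1 t
  have e2 := eq_exp_mul_mul_exp h2 t
  simp only [h.lam_zero, Matrix.toCols₁_fromCols, Matrix.toCols₂_fromCols, smul_zero,
    NormedSpace.exp_zero, Matrix.mul_one, smul_smul, mul_comm _ (-2 : ℂ)] at e1 e2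
  rw [← Matrix.fromCols_toCols (Λ t), e1, e2, lamEvol]

/-! ### Time evolution of the quadruple. -/

section

variable {α S₀ : Matrix (Fin n) (Fin n) ℂ} {θ₁ : Matrix (Fin n) (Fin m₁) ℂ}
  {θ₂ : Matrix (Fin n) (Fin m₂) ℂ}

/-- The operator `X ↦ α X - X α*`. -/
noncomputable def sylvester (α : Matrix (Fin n) (Fin n) ℂ) :
    Matrix (Fin n) (Fin n) ℂ →ₗ[ℂ] Matrix (Fin n) (Fin n) ℂ :=
  LinearMap.mulLeft ℂ α - LinearMap.mulRight ℂ αᴴ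

theorem sylvester_apply (X : Matrix (Fin n) (Fin n) ℂ) : sylvester α X = α * X - X * αᴴ := rfl

theorem IsStronglyAdmissible.sylvester_injective (h : IsStronglyAdmissible α S₀ θ₁ θ₂) :
    Function.Injective (sylvester α) := by
  rw [injective_iff_map_eq_zero]
  intro X hX
  rw [sylvester_apply, sub_eq_zero] at hX
  refine eq_zero_of_sylvester (fun μ hμ hμ' => ?_) hX
  have p1 := h.im_pos hμ
  have p2 := h.im_pos (mem_spectrum_conjTranspose.1 hμ')
  simp at p2
  linarith

/-- `S` is defined through the inverse of the Sylvester operator rather than by integration, so the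
Lyapunov identity holds for every `t` by construction. -/
theorem IsStronglyAdmissible.exists_isTimeEvolution (h : IsStronglyAdmissible α S₀ θ₁ θ₂)
    (hi : Complex.I ∉ spectrum ℂ α) :
    ∃ S : ℝ → Matrix (Fin n) (Fin n) ℂ, IsTimeEvolution α S₀ θ₁ θ₂ (lamEvol α θ₁ θ₂) S ∧
      ∀ t, α * S t - S t * αᴴ = Complex.I • (lamEvol α θ₁ θ₂ t * (lamEvol α θ₁ θ₂ t)ᴴ) := by
  let L := LinearEquiv.ofInjectiveEndo (sylvester α) h.sylvester_injective
  have hL : ∀ X, L X = α * X - X * αᴴ := fun X => rfl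
  let S : ℝ → Matrix (Fin n) (Fin n) ℂ := fun t =>
    L.symm (Complex.I • (lamEvol α θ₁ θ₂ t * (lamEvol α θ₁ θ₂ t)ᴴ))
  have hS : ∀ t, α * S t - S t * αᴴ
      = Complex.I • (lamEvol α θ₁ θ₂ t * (lamEvol α θ₁ θ₂ t)ᴴ) := fun t => by
    rw [← hL, LinearEquiv.apply_symm_apply]
  have h0 : lamEvol α θ₁ θ₂ 0 = Matrix.fromCols θ₁ θ₂ := by simp [lamEvol]
  refine ⟨S, ⟨h0, ?_, hasDerivAt_lamEvol α θ₁ θ₂, fun t => ?_⟩, hS⟩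
  · apply L.injective
    rw [hL, hL, hS, h.1.2, h0, mul_conjTranspose_eq_toCols, Matrix.toCols₁_fromCols,
      Matrix.toCols₂_fromCols]
  · have hd := hasDerivAt_lamEvol α θ₁ θ₂ t
    set D := (-2 : ℂ) • ((α - Complex.I • 1)⁻¹ * lamEvol α θ₁ θ₂ t * proj₁ m₁ m₂
        + (α + Complex.I • 1)⁻¹ * lamEvol α θ₁ θ₂ t * proj₂ m₁ m₂) with hD
    have hprod := HasDerivAt.matrixMul hd (HasDerivAt.matrixConjTranspose hd)
    have hS' : HasDerivAt S (L.symm (Complex.I • (D * (lamEvol α θ₁ θ₂ t)ᴴ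
        + lamEvol α θ₁ θ₂ t * Dᴴ))) t :=
      HasDerivAt.matrixLinearMap
        (L.symm.toLinearMap ∘ₗ LinearMap.lsmul ℂ (Matrix (Fin n) (Fin n) ℂ) Complex.I) hprod
    have he : L.symm (Complex.I • (D * (lamEvol α θ₁ θ₂ t)ᴴ + lamEvol α θ₁ θ₂ t * Dᴴ))
        = evolS α (S t) (lamEvol α θ₁ θ₂ t) := by
      rw [LinearEquiv.symm_apply_eq, hL]
      exact (sylvester_evolS (sub_smul_isUnit_of_notMem_spectrum hi) h.isUnit_add_I (hS t) hD).symm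
    rw [he] at hS'
    exact hS'

theorem IsTimeEvolution.S_unique {Λ : ℝ → Matrix (Fin n) (Fin m₁ ⊕ Fin m₂) ℂ}
    {S T : ℝ → Matrix (Fin n) (Fin n) ℂ} (hS : IsTimeEvolution α S₀ θ₁ θ₂ Λ S)
    (hT : IsTimeEvolution α S₀ θ₁ θ₂ Λ T) : S = T := by
  have hd : ∀ t, HasDerivAt (fun s => S s - T s)
      (-((α - Complex.I • 1)⁻¹ + (α + Complex.I • 1)⁻¹) * (S t - T t)
        + (S t - T t) * -((αᴴ + Complex.I • 1)⁻¹ + (αᴴ - Complex.I • 1)⁻¹)) t := by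
    intro t
    rw [← evolS_sub (Λ := Λ t)]
    rw [hasDerivAt_matrix_iff]
    exact fun i j => (hasDerivAt_matrix_iff.1 (hS.S_deriv t) i j).sub
      (hasDerivAt_matrix_iff.1 (hT.S_deriv t) i j)
  funext t
  have := eq_exp_mul_mul_exp hd t
  simp only [hS.S_zero, hT.S_zero, sub_self, Matrix.mul_zero, Matrix.zero_mul] at this
  exact sub_eq_zero.1 this

theorem IsStronglyAdmissible.existsUnique_isTimeEvolution (h : IsStronglyAdmissible α S₀ θ₁ θ₂)
    (hi : Complex.I ∉ spectrum ℂ α) :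
    ∃! p : (ℝ → Matrix (Fin n) (Fin m₁ ⊕ Fin m₂) ℂ) × (ℝ → Matrix (Fin n) (Fin n) ℂ),
      IsTimeEvolution α S₀ θ₁ θ₂ p.1 p.2 := by
  obtain ⟨T, hT, -⟩ := h.exists_isTimeEvolution hi
  refine ⟨(lamEvol α θ₁ θ₂, T), hT, ?_⟩
  rintro ⟨Λ, S⟩ hp
  obtain rfl : Λ = lamEvol α θ₁ θ₂ := hp.lam_eq
  exact Prod.ext rfl (IsTimeEvolution.S_unique hp hT)

/-- Controllability survives because the exponential is invertible and commutes with `α`; positivity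
follows by comparison with `S₀`. -/
theorem IsStronglyAdmissible.evolution {Λ : ℝ → Matrix (Fin n) (Fin m₁ ⊕ Fin m₂) ℂ}
    {S : ℝ → Matrix (Fin n) (Fin n) ℂ} (h : IsStronglyAdmissible α S₀ θ₁ θ₂)
    (hi : Complex.I ∉ spectrum ℂ α) (hev : IsTimeEvolution α S₀ θ₁ θ₂ Λ S) (t : ℝ) :
    IsStronglyAdmissible α (S t) (Λ t).toCols₁ (Λ t).toCols₂ := by
  obtain ⟨T, hT, hl⟩ := h.exists_isTimeEvolution hi
  obtain rfl := hev.lam_eq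
  obtain rfl := hev.S_unique hT
  -- The adjoint of `S t` solves the same Sylvester equation, whose solution is unique.
  have hH : (S t).IsHermitian := by
    apply h.sylvester_injective
    rw [sylvester_apply, sylvester_apply, hl t]
    have := congrArg Matrix.conjTranspose (hl t)
    simp only [Matrix.conjTranspose_sub, Matrix.conjTranspose_mul, Matrix.conjTranspose_smul,
      Matrix.conjTranspose_conjTranspose, Complex.star_def, Complex.conj_I] at this
    linear_combination (norm := module) -this
  have hc : IsControllable α (lamEvol α θ₁ θ₂ t).toCols₁ := by
    rw [lamEvol, Matrix.toCols₁_fromCols]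
    exact h.2.mul_left (Matrix.isUnit_exp _) (commute_exp
      ((commute_inv_sub_smul (sub_smul_isUnit_of_notMem_spectrum hi)).smul_right _))
  refine isStronglyAdmissible_toCols_iff.2 ⟨?_, hl t, hc⟩
  refine posDef_of_lyapunov h.1.1 ((Matrix.posSemidef_self_mul_conjTranspose _).add
    (Matrix.posSemidef_self_mul_conjTranspose _)) h.1.2 hc hH
    (Matrix.posSemidef_self_mul_conjTranspose (lamEvol α θ₁ θ₂ t).toCols₂) ?_
  rw [hl t, mul_conjTranspose_eq_toCols]

theorem conjTranspose_exp_neg_two_smul (A : Matrix (Fin n) (Fin n) ℂ) (t : ℝ) :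
    (NormedSpace.exp ((-2 * t : ℂ) • A⁻¹))ᴴ = NormedSpace.exp ((-2 * t : ℂ) • (Aᴴ)⁻¹) := by
  rw [← Matrix.exp_conjTranspose, Matrix.conjTranspose_smul, Matrix.conjTranspose_nonsing_inv]
  simp

theorem beta_eq (α S : Matrix (Fin n) (Fin n) ℂ) (θ₁ : Matrix (Fin n) (Fin m₁) ℂ)
    (θ₂ : Matrix (Fin n) (Fin m₂) ℂ) (t : ℝ) :
    beta α S θ₂ t = α - Complex.I • ((lamEvol α θ₁ θ₂ t).toCols₂
      * (lamEvol α θ₁ θ₂ t).toCols₂ᴴ * S⁻¹) := by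
  have hc₂ : (α + Complex.I • 1)ᴴ = αᴴ - Complex.I • 1 := by
    simp [Matrix.conjTranspose_add, sub_eq_add_neg]
  rw [beta, lamEvol, Matrix.toCols₂_fromCols, Matrix.conjTranspose_mul,
    conjTranspose_exp_neg_two_smul, hc₂]
  simp only [Matrix.mul_assoc]

/-- Taking adjoints exchanges `(α - i)⁻¹` with `(α* + i)⁻¹`, so the exponentials in the formula are
those contained in the blocks of `Λ(t)` and their adjoints. -/
theorem weylFormula_eq (α S : Matrix (Fin n) (Fin n) ℂ) (θ₁ : Matrix (Fin n) (Fin m₁) ℂ)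
    (θ₂ : Matrix (Fin n) (Fin m₂) ℂ) (t : ℝ) :
    weylFormula α S θ₁ θ₂ t = weylState α S (lamEvol α θ₁ θ₂ t) := by
  funext z
  have hc₁ : (α - Complex.I • 1)ᴴ = αᴴ + Complex.I • 1 := by
    rw [conjTranspose_sub_smul_one]; simp
  rw [weylFormula, weylState, beta_eq α S θ₁ θ₂ t, lamEvol, Matrix.toCols₁_fromCols,
    Matrix.toCols₂_fromCols, Matrix.conjTranspose_mul _ θ₁, conjTranspose_exp_neg_two_smul, hc₁]
  simp only [Matrix.mul_assoc]

end

end DGHM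

theorem corollary4p3 {n m₁ m₂ : ℕ} (α S₀ : Matrix (Fin n) (Fin n) ℂ)
    (θ₁ : Matrix (Fin n) (Fin m₁) ℂ) (θ₂ : Matrix (Fin n) (Fin m₂) ℂ)
    (hadm : DGHM.IsStronglyAdmissible α S₀ θ₁ θ₂) (hi : Complex.I ∉ spectrum ℂ α) :
    (∃! p : (ℝ → Matrix (Fin n) (Fin m₁ ⊕ Fin m₂) ℂ) × (ℝ → Matrix (Fin n) (Fin n) ℂ),
      DGHM.IsTimeEvolution α S₀ θ₁ θ₂ p.1 p.2) ∧
    ∀ (Λ : ℝ → Matrix (Fin n) (Fin m₁ ⊕ Fin m₂) ℂ) (S : ℝ → Matrix (Fin n) (Fin n) ℂ),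
      DGHM.IsTimeEvolution α S₀ θ₁ θ₂ Λ S → ∀ t : ℝ,
        (∀ k : ℕ, DGHM.IsStronglyAdmissible α (DGHM.SSeq α (Λ t) (S t) k)
          (DGHM.lamSeq α (Λ t) k).toCols₁ (DGHM.lamSeq α (Λ t) k).toCols₂) ∧
        DGHM.IsDiracPotential (DGHM.potential α (Λ t) (S t)) ∧
        DGHM.IsWeylFunction (1 / 2) (DGHM.potential α (Λ t) (S t))
          (DGHM.weylFormula α (S t) θ₁ θ₂ t) ∧
        (∀ z : ℂ, 1 / 2 < z.im → IsUnit (z • 1 + DGHM.beta α (S t) θ₂ t) →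
          DGHM.WeylSummable (DGHM.potential α (Λ t) (S t)) z
            (DGHM.weylFormula α (S t) θ₁ θ₂ t z)) ∧
        ∀ (M : ℝ) (φ : ℂ → Matrix (Fin m₁) (Fin m₂) ℂ),
          DGHM.IsWeylFunction M (DGHM.potential α (Λ t) (S t)) φ →
            ∀ᶠ z in Filter.codiscreteWithin (DGHM.halfPlane M),
              φ z = DGHM.weylFormula α (S t) θ₁ θ₂ t z := by
  refine ⟨hadm.existsUnique_isTimeEvolution hi, fun Λ S hev t => ?_⟩
  have ht := hadm.evolution hi hev t
  have hf : DGHM.weylFormula α (S t) θ₁ θ₂ t = DGHM.weylState α (S t) (Λ t) := by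
    rw [hev.lam_eq, DGHM.weylFormula_eq]
  rw [hf]
  refine ⟨ht.seq hi, ht.isDiracPotential hi, ht.isWeylFunction hi, fun z hz hβ => ?_,
    fun M φ hφ => ht.weylFunction_unique hi hφ⟩
  rw [DGHM.beta_eq α (S t) θ₁ θ₂ t, ← hev.lam_eq] at hβ
  exact ht.weylSummable hi hz hβ
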